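/- Let $m\ge 1$ and let $A_1,\dots,A_m$ be invertible real $2\times2$ matrices with strictly positive entries and Euclidean operator norm $\|A_i\|_2<1$, let $d_1,\dots,d_m\in\mathbb R^2$, and put $T_i x=A_i x+d_i$. Let $E\subset\mathbb R^2$ be the self-affine set defined by this system, that is, the non-empty compact set with $E=\bigcup_{i=1}^m T_i(E)$, and suppose that this union is disjoint (strong separation). For an invertible matrix $A$ with singular values $\alpha_1(A)\ge\alpha_2(A)>0$ put $\phi^s(A)=\alpha_1(A)^s$ for $0<s\le1$ and $\phi^s(A)=\alpha_1(A)\alpha_2(A)^{s-1}$ for $s\ge1$; the affinity dimension is $$\dim_A E=\inf\Big\{s>0:\sum_{n=1}^\infty\ \sum_{a_1\cdots a_n\in\{1,\dots,m\}^n}\phi^s(A_{a_1}\cdots A_{a_n})<\infty\Big\}.$$ Let $\mu$ be a Käenmäki measure of $(A_1,\dots,A_m)$, that is, a probability measure on $\Sigma=\{1,\dots,m\}^{\mathbb N}$, invariant and ergodic under the left shift $\sigma$, such that $D(\mu)=\dim_A E$. Here $D(\mu)=h(\mu)/(-\lambda_1)$ if $h(\mu)\le-\lambda_1$ and $D(\mu)=1+(h(\mu)+\lambda_1)/(-\lambda_2)$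 otherwise, where $h(\mu)$ is the Kolmogorov–Sinai entropy of $(\Sigma,\sigma,\mu)$ and $\lambda_1,\lambda_2$ are the Lyapunov exponents, the constants with $\frac1n\log\alpha_i(A_{a_1}\cdots A_{a_n})\to\lambda_i$ for $\mu$-almost every $a\in\Sigma$. Let $\phi_i$ be the transformation of the projective line $\mathbb{RP}^1$ induced by $A_i^{-1}$, and let $\mu_F$ be the corresponding Furstenberg measure: the probability measure on $\mathbb{RP}^1$ such that, for $\mu$-almost every $a\in\Sigma$ and all directions $\theta$ of the negative quadrant $\mathcal Q_2\subset\mathbb{RP}^1$ (lines of non-positive slope, and the vertical line), the measures $\frac1n\sum_{k=0}^{n-1}\delta_{\phi_{a_k}\cdots\phi_{a_1}(\theta)}$ converge weakly to $\mu_F$ as $n\to\infty$. For $\theta\in\mathbb{RP}^1$ let $\pi_\theta$ be the orthogonal projection of $\mathbb R^2$ along $\theta$ onto the line $\theta^\perp$, identified isometrically with $\mathbb R$, and let $\mathcal L$ be Lebesgue measure on $\mathbb R$. If $$\mu_F\big(\{\theta\in\mathbb{RP}^1:\mathcal L(\pi_\theta(E))>0\}\big)>0,$$ then the box-counting dimension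 of $E$ exists and $\dim_B E=\dim_A E$; that is, $\lim_{\varepsilon\to0^+}\log N(\varepsilon,E)/(-\log\varepsilon)=\dim_A E$, where $N(\varepsilon,E)$ is the least number of balls of radius $\varepsilon$ that cover $E$. -/

import Mathlib

open MeasureTheory Filter Topology Matrix
open scoped LinearAlgebra.Projectivization NNReal BoundedContinuousFunction

noncomputable section

/-! ### Self-affine sets and the affinity dimension -/

/-- The affine map `x ↦ A x + d` of the Euclidean plane. -/
def affineMapOf (A : GL (Fin 2) ℝ) (d x : EuclideanSpace ℝ (Fin 2)) : EuclideanSpace ℝ (Fin 2) :=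
  Matrix.toEuclideanCLM (𝕜 := ℝ) (A : Matrix (Fin 2) (Fin 2) ℝ) x + d

/-- The larger singular value `α₁` of a `2 × 2` matrix. -/
def sv₁ (A : Matrix (Fin 2) (Fin 2) ℝ) : ℝ := (Matrix.toEuclideanLin A).singularValues 0

/-- The smaller singular value `α₂` of a `2 × 2` matrix. -/
def sv₂ (A : Matrix (Fin 2) (Fin 2) ℝ) : ℝ := (Matrix.toEuclideanLin A).singularValues 1

/-- The singular value function `φ^s`. -/
def svFunction (s : ℝ) (A : Matrix (Fin 2) (Fin 2) ℝ) : ℝ :=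
  if s ≤ 1 then sv₁ A ^ s else sv₁ A * sv₂ A ^ (s - 1)

/-- The product `A_{w 0} A_{w 1} ⋯ A_{w (n-1)}` along a finite word `w`. -/
def wordProd {m : ℕ} (A : Fin m → GL (Fin 2) ℝ) {n : ℕ} (w : Fin n → Fin m) :
    Matrix (Fin 2) (Fin 2) ℝ :=
  ((List.ofFn fun k => A (w k)).prod : GL (Fin 2) ℝ)

/-- The affinity dimension: the infimum of those `s > 0` for which the sum of `φ^s(A_w)` over all
finite words `w` of length at least one converges. -/
def affinityDim {m : ℕ} (A : Fin m → GL (Fin 2) ℝ) : ℝ :=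
  sInf {s : ℝ | 0 < s ∧
    Summable fun n : ℕ => ∑ w : Fin (n + 1) → Fin m, svFunction s (wordProd A w)}

/-- The compact set `F` has box-counting dimension `d`, i.e. its lower and upper box-counting
dimensions, defined from the least number of (closed) balls of radius `ε` covering `F`,
are both equal to `d`. -/
def HasBoxDim (F : Set (EuclideanSpace ℝ (Fin 2))) (d : ℝ) : Prop :=
  Tendsto (fun ε : ℝ≥0 =>
    Real.log ((Metric.externalCoveringNumber ε F).toNat : ℝ) / -Real.log (ε : ℝ))
    (𝓝[>] 0) (𝓝 d)

/-! ### Kolmogorov–Sinai entropy -/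

/-- The Shannon entropy of the join `ξ ∨ T⁻¹ ξ ∨ ⋯ ∨ T⁻⁽ⁿ⁻¹⁾ ξ`, where the finite partition `ξ` is
given by the function sending a point to the label of its cell. -/
def joinEntropy {Ω : Type*} [MeasurableSpace Ω] (T : Ω → Ω) (μ : Measure Ω) {k : ℕ}
    (ξ : Ω → Fin k) (n : ℕ) : ℝ :=
  ∑ w : Fin n → Fin k, Real.negMulLog (μ.real {x | ∀ j : Fin n, ξ (T^[j] x) = w j})

/-- The Kolmogorov–Sinai entropy of the system `(Ω, T, μ)`: the supremum over all finite measurable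
partitions of the entropy rate. -/
def ksEntropy {Ω : Type*} [MeasurableSpace Ω] (T : Ω → Ω) (μ : Measure Ω) : EReal :=
  ⨆ (k : ℕ) (ξ : Ω → Fin k) (_ : Measurable ξ),
    limsup (fun n : ℕ => ((joinEntropy T μ ξ n / n : ℝ) : EReal)) atTop

/-! ### Käenmäki measures -/

/-- The left shift on the sequence space `{1, …, m}^ℕ`. -/
def leftShift {m : ℕ} (a : ℕ → Fin m) : ℕ → Fin m := fun n => a (n + 1)

/-- The initial word of length `n` of an infinite sequence. -/
def initialWord {m : ℕ} (a : ℕ → Fin m) (n : ℕ) : Fin n → Fin m := fun k => a k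

/-- The numbers `l₁, l₂` are the Lyapunov exponents of `μ`: almost surely they are the exponential
growth rates of the singular values `α₁, α₂` of `A_{a 0} ⋯ A_{a (n-1)}`. -/
def AreLyapunovExponents {m : ℕ} (A : Fin m → GL (Fin 2) ℝ) (μ : Measure (ℕ → Fin m))
    (l₁ l₂ : ℝ) : Prop :=
  ∀ᵐ a ∂μ,
    Tendsto (fun n : ℕ => Real.log (sv₁ (wordProd A (initialWord a n))) / n) atTop (𝓝 l₁) ∧
    Tendsto (fun n : ℕ => Real.log (sv₂ (wordProd A (initialWord a n))) / n) atTop (𝓝 l₂)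

/-- The Lyapunov dimension in terms of the entropy `h` and the Lyapunov exponents `l₁, l₂`. -/
def lyapunovDim (h l₁ l₂ : ℝ) : ℝ :=
  if h ≤ -l₁ then h / -l₁ else 1 + (h + l₁) / -l₂

/-- `μ` is a Käenmäki measure: an ergodic shift-invariant probability measure on the sequence space
whose Lyapunov dimension equals the affinity dimension. -/
structure IsKaenmakiMeasure {m : ℕ} (A : Fin m → GL (Fin 2) ℝ) (μ : Measure (ℕ → Fin m)) :
    Prop where
  isProbabilityMeasure : IsProbabilityMeasure μ
  ergodic : Ergodic leftShift μ
  lyapunovDim_eq : ∃ h l₁ l₂ : ℝ, ksEntropy leftShift μ = (h : EReal) ∧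
    AreLyapunovExponents A μ l₁ l₂ ∧ lyapunovDim h l₁ l₂ = affinityDim A

/-! ### The projective line and the Furstenberg measure -/

/-- The real projective line: the lines through the origin in `ℝ²`. -/
abbrev RP1 : Type := ℙ ℝ (Fin 2 → ℝ)

/-- The quotient topology on the projective line. -/
instance instTopologicalSpaceRP1 : TopologicalSpace RP1 :=
  TopologicalSpace.coinduced
    (fun v : {v : Fin 2 → ℝ // v ≠ 0} => Projectivization.mk ℝ v.1 v.2) inferInstance

instance instMeasurableSpaceRP1 : MeasurableSpace RP1 := borel RP1

instance instBorelSpaceRP1 : BorelSpace RP1 := ⟨rfl⟩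

/-- The negative quadrant of the projective line: lines with no points in the open first quadrant
(the two axes are included). -/
def negQuadrant : Set RP1 := {θ | θ.rep 0 * θ.rep 1 ≤ 0}

/-- The orbit of a direction `θ` under the projective maps `φ_i` induced by `A_i⁻¹`: at time `k` it
is `φ_{a (k-1)} ⋯ φ_{a 0} θ`. -/
def directionOrbit {m : ℕ} (A : Fin m → GL (Fin 2) ℝ) (a : ℕ → Fin m) (θ : RP1) : ℕ → RP1
  | 0 => θ
  | k + 1 => (A (a k))⁻¹ • directionOrbit A a θ k

/-- `μF` is the Furstenberg measure associated with `μ`: for `μ`-almost every sequence `a` and all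
`θ` in the negative quadrant, the empirical measures of the orbit of `θ` converge weakly to `μF`. -/
structure IsFurstenbergMeasure {m : ℕ} (A : Fin m → GL (Fin 2) ℝ) (μ : Measure (ℕ → Fin m))
    (μF : Measure RP1) : Prop where
  isProbabilityMeasure : IsProbabilityMeasure μF
  tendsto : ∀ᵐ a ∂μ, ∀ θ ∈ negQuadrant, ∀ f : RP1 →ᵇ ℝ,
    Tendsto (fun n : ℕ => (∑ k ∈ Finset.range n, f (directionOrbit A a θ k)) / n) atTop
      (𝓝 (∫ ϑ, f ϑ ∂μF))

/-- Projection of the plane in direction `θ`: the signed coordinate of the orthogonal projection of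
`x` onto the line perpendicular to `θ`. (The sign depends on the representative of `θ`.) -/
def projAlong (θ : RP1) (x : EuclideanSpace ℝ (Fin 2)) : ℝ :=
  (θ.rep 0 * x 1 - θ.rep 1 * x 0) / √(θ.rep 0 ^ 2 + θ.rep 1 ^ 2)

end

/-!
# Box dimension of planar self-affine sets with large projections

Write `s` for the affinity dimension, `A_w` for the product along a word `w` and `E_w` for the
corresponding piece of `E`.

*Upper bound.* The piece `E_w` lies in an ellipse with axes comparable to `α₁(A_w)` and `α₂(A_w)`,
so it is covered by about `α₁ / α₂ = φ^t(A_w) α₂^(-t)` balls of radius `α₂`. Using the words for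
which `α₂(A_w)` is comparable to `r`, a convergent sum at exponent `t > 1` bounds the covering number of
`E` at scale `r` by a multiple of `r^(-t)` (`exists_coveringNumber_le`). Exponents `t ≤ 1` never give a
convergent sum: otherwise the projections of `E`, which are covered by intervals of length about
`α₁(A_w)`, would be null sets (`one_lt_of_summable_svFunction`). In particular `s ≥ 1`.

*Lower bound.* If `h(μ) ≤ -λ₁` then `s ≤ 1`, and one projection of positive measure suffices.
Suppose that `h(μ) > -λ₁`, so that `h(μ) + λ₁ + (s - 1) λ₂ = 0`.

* The function `θ ↦ |π_θ E|` is upper semicontinuous, so it is at least some `c > 0` on a closed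
  set `G` of directions with `μ_F(G) > 0`. The orbit of one direction need not visit `G`. But the
  position of the orbit at time `k` lies in the image of the negative quadrant under the last `n`
  maps, and for a word none of whose images meets `G` this is a compact set disjoint from `G`.
  Testing the convergence to `μ_F` on a continuous function that separates these sets, and
  integrating against the invariant measure `μ`, shows that for every `n` the words `w` of length
  `n` such that `A_w⁻¹` maps some direction of the negative quadrant into `G` have `μ`-measure at
  least `μ_F(G)` (`measureReal_le_visitingWords`). For such `w` some projection of `E_w` has measure
  at least a constant times `α₁(A_w)` (`exists_long_projection`).
* The Kolmogorov–Sinai theorem and subadditivity give `H_n ≥ n h(μ)` for the entropy of the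
  cylinders of length `n` (`mul_ksEntropy_le_wordEntropy`). Hence entropy plus energy, that is
  `H_n + ∑ μ[w] log φ^s(A_w)`, is at least `-o(n)`, while `log ∑ φ^s(A_w) ≤ o(n)` by the definition
  of `s`. By a log-sum inequality every set of words of length `n` with `μ`-measure bounded below
  then carries at least `e^(-o(n))` of the sum of `φ^s(A_w)` (`eventually_exists_heavy_words`). This
  replaces the Shannon–McMillan–Breiman theorem and the Gibbs property of `μ`.
* Strong separation keeps the pieces `E_w` with `α₂(A_w) ≥ r` at mutual distance at least a constant
  times `r` (`wordMap_separation`). So the covering number at scale `r ≈ e^(n λ₂)` is at least the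
  sum of `α₁(A_w) / r ≈ r^(-s) φ^s(A_w)` over the visiting words of typical size, which is
  `r^(-s) e^(-o(n))` (`exists_le_coveringNumber`).
-/

/-- The Euclidean plane. -/
local notation "ℝ²" => EuclideanSpace ℝ (Fin 2)

/-- A planar matrix acting on the Euclidean plane. -/
local notation "act" => Matrix.toEuclideanCLM (n := Fin 2) (𝕜 := ℝ)

noncomputable section

/-! ### Singular values of planar matrices -/

/-- A singular value decomposition: right singular vectors, with orthogonal images. -/
theorem exists_singularBasis (A : Matrix (Fin 2) (Fin 2) ℝ) :
    ∃ b : OrthonormalBasis (Fin 2) ℝ ℝ², ‖act A (b 0)‖ = sv₁ A ∧ ‖act A (b 1)‖ = sv₂ A ∧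
      inner ℝ (act A (b 0)) (act A (b 1)) = 0 := by
  set T := Matrix.toEuclideanLin A with hT
  have hr : Module.finrank ℝ ℝ² = 2 := by simp
  have hs := T.isSymmetric_adjoint_comp_self
  set b := hs.eigenvectorBasis hr with hb
  have key : ∀ i j, inner ℝ (act A (b i)) (act A (b j)) =
      (T.singularValues i) ^ 2 * inner ℝ (b i) (b j) := by
    intro i j
    have h1 : inner ℝ (act A (b i)) (act A (b j)) =
        inner ℝ ((LinearMap.adjoint T ∘ₗ T) (b i)) (b j) := by
      rw [LinearMap.comp_apply, LinearMap.adjoint_inner_left]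
      rfl
    rw [h1, hb, hs.apply_eigenvectorBasis, T.sq_singularValues_fin hr]
    simp [inner_smul_left]
  refine ⟨b, ?_, ?_, ?_⟩
  · have := key 0 0
    rw [real_inner_self_eq_norm_sq, real_inner_self_eq_norm_sq, b.norm_eq_one] at this
    have h2 : 0 ≤ sv₁ A := T.singularValues_nonneg 0
    exact (sq_eq_sq₀ (norm_nonneg _) h2).1 (by rw [this]; simp [sv₁, hT])
  · have := key 1 1
    rw [real_inner_self_eq_norm_sq, real_inner_self_eq_norm_sq, b.norm_eq_one] at this
    have h2 : 0 ≤ sv₂ A := T.singularValues_nonneg 1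
    exact (sq_eq_sq₀ (norm_nonneg _) h2).1 (by rw [this]; simp [sv₂, hT])
  · rw [key 0 1, b.inner_eq_zero (by decide)]
    simp

theorem sv₁_nonneg (A : Matrix (Fin 2) (Fin 2) ℝ) : 0 ≤ sv₁ A :=
  LinearMap.singularValues_nonneg _ 0

theorem sv₂_nonneg (A : Matrix (Fin 2) (Fin 2) ℝ) : 0 ≤ sv₂ A :=
  LinearMap.singularValues_nonneg _ 1

theorem sv₂_le_sv₁ (A : Matrix (Fin 2) (Fin 2) ℝ) : sv₂ A ≤ sv₁ A :=
  LinearMap.singularValues_antitone _ zero_le_one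

theorem sv₁_mul_sv₂ (A : Matrix (Fin 2) (Fin 2) ℝ) : sv₁ A * sv₂ A = |A.det| := by
  have h := (Matrix.toEuclideanLin A).normDet_eq_prod_singularValues
  rw [LinearMap.normDet_eq_abs_det] at h
  have h2 : (Matrix.toEuclideanLin A).det = A.det := by
    exact LinearMap.det_toLpLin 2 A
  simpa [Finset.prod_range_succ, h2, sv₁, sv₂] using h.symm

theorem norm_sq_act_eq (A : Matrix (Fin 2) (Fin 2) ℝ) {b : OrthonormalBasis (Fin 2) ℝ ℝ²}
    (h₀ : ‖act A (b 0)‖ = sv₁ A) (h₁ : ‖act A (b 1)‖ = sv₂ A)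
    (h : inner ℝ (act A (b 0)) (act A (b 1)) = 0) (x : ℝ²) :
    ‖act A x‖ ^ 2 = sv₁ A ^ 2 * b.repr x 0 ^ 2 + sv₂ A ^ 2 * b.repr x 1 ^ 2 := by
  conv_lhs => rw [← b.sum_repr x]
  rw [Fin.sum_univ_two, map_add, map_smul, map_smul, norm_add_sq_real, inner_smul_left,
    inner_smul_right, h, norm_smul, norm_smul, h₀, h₁, mul_pow, mul_pow]
  simp only [Real.norm_eq_abs, sq_abs]
  simp
  ring

theorem norm_act_le (A : Matrix (Fin 2) (Fin 2) ℝ) (x : ℝ²) : ‖act A x‖ ≤ sv₁ A * ‖x‖ := by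
  obtain ⟨b, h₀, h₁, h⟩ := exists_singularBasis A
  refine le_of_sq_le_sq ?_ (mul_nonneg (sv₁_nonneg A) (norm_nonneg x))
  rw [norm_sq_act_eq A h₀ h₁ h, ← b.repr.norm_map x, mul_pow, EuclideanSpace.norm_sq_eq]
  simp only [Fin.sum_univ_two, Real.norm_eq_abs, sq_abs]
  have := pow_le_pow_left₀ (sv₂_nonneg A) (sv₂_le_sv₁ A) 2
  nlinarith [sq_nonneg (b.repr x 1)]

theorem sv₂_mul_norm_le (A : Matrix (Fin 2) (Fin 2) ℝ) (x : ℝ²) :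
    sv₂ A * ‖x‖ ≤ ‖act A x‖ := by
  obtain ⟨b, h₀, h₁, h⟩ := exists_singularBasis A
  refine le_of_sq_le_sq ?_ (norm_nonneg _)
  rw [norm_sq_act_eq A h₀ h₁ h, ← b.repr.norm_map x, mul_pow, EuclideanSpace.norm_sq_eq]
  simp only [Fin.sum_univ_two, Real.norm_eq_abs, sq_abs]
  have := pow_le_pow_left₀ (sv₂_nonneg A) (sv₂_le_sv₁ A) 2
  nlinarith [sq_nonneg (b.repr x 0)]

theorem sv₁_eq_norm (A : Matrix (Fin 2) (Fin 2) ℝ) : sv₁ A = ‖act A‖ := by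
  refine le_antisymm ?_ ((act A).opNorm_le_bound (sv₁_nonneg A) (norm_act_le A))
  obtain ⟨b, h₀, -⟩ := exists_singularBasis A
  rw [← h₀]
  exact (act A).unit_le_opNorm _ (b.norm_eq_one 0).le

theorem sv₁_mul_le (A B : Matrix (Fin 2) (Fin 2) ℝ) : sv₁ (A * B) ≤ sv₁ A * sv₁ B := by
  rw [sv₁_eq_norm, sv₁_eq_norm, sv₁_eq_norm, map_mul]
  exact norm_mul_le _ _

theorem act_mul_apply (A B : Matrix (Fin 2) (Fin 2) ℝ) (x : ℝ²) :
    act (A * B) x = act A (act B x) := by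
  rw [map_mul]; rfl

theorem mul_sv₂_le (A B : Matrix (Fin 2) (Fin 2) ℝ) : sv₂ A * sv₂ B ≤ sv₂ (A * B) := by
  obtain ⟨b, -, h, -⟩ := exists_singularBasis (A * B)
  rw [← h, act_mul_apply]
  refine le_trans ?_ (sv₂_mul_norm_le A _)
  have := sv₂_mul_norm_le B (b 1)
  rw [b.norm_eq_one, mul_one] at this
  exact mul_le_mul_of_nonneg_left this (sv₂_nonneg A)

/-- The smaller singular value is submultiplicative up to the norm of the right factor. -/
theorem sv₂_mul_le (A : Matrix (Fin 2) (Fin 2) ℝ) (B : GL (Fin 2) ℝ) :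
    sv₂ (A * B) ≤ sv₂ A * sv₁ (B : Matrix (Fin 2) (Fin 2) ℝ) := by
  obtain ⟨b, -, h, -⟩ := exists_singularBasis A
  set x := act ((B⁻¹ : GL (Fin 2) ℝ) : Matrix (Fin 2) (Fin 2) ℝ) (b 1) with hx
  have hBx : act (B : Matrix (Fin 2) (Fin 2) ℝ) x = b 1 := by
    rw [hx, ← act_mul_apply, ← Units.val_mul]
    simp
  have h1 := sv₂_mul_norm_le (A * B) x
  rw [act_mul_apply, hBx, h] at h1
  have h2 := norm_act_le (B : Matrix (Fin 2) (Fin 2) ℝ) x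
  rw [hBx, b.norm_eq_one] at h2
  have h3 := sv₂_nonneg (A * B)
  have h4 := sv₁_nonneg (B : Matrix (Fin 2) (Fin 2) ℝ)
  nlinarith [mul_le_mul_of_nonneg_left h2 h3, mul_le_mul_of_nonneg_right h1 h4]

theorem sv₂_pos (A : GL (Fin 2) ℝ) : 0 < sv₂ (A : Matrix (Fin 2) (Fin 2) ℝ) := by
  refine lt_of_le_of_ne (sv₂_nonneg _) fun h => ?_
  have h2 := sv₁_mul_sv₂ (A : Matrix (Fin 2) (Fin 2) ℝ)
  rw [← h, mul_zero] at h2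
  exact A.det_ne_zero (abs_eq_zero.1 h2.symm)

theorem sv₁_pos (A : GL (Fin 2) ℝ) : 0 < sv₁ (A : Matrix (Fin 2) (Fin 2) ℝ) :=
  (sv₂_pos A).trans_le (sv₂_le_sv₁ _)

theorem sv₁_one : sv₁ (1 : Matrix (Fin 2) (Fin 2) ℝ) = 1 := by
  rw [sv₁_eq_norm, map_one, norm_one]

theorem sv₂_one : sv₂ (1 : Matrix (Fin 2) (Fin 2) ℝ) = 1 := by
  have := sv₁_mul_sv₂ (1 : Matrix (Fin 2) (Fin 2) ℝ)
  simpa [sv₁_one] using this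

/-! ### Products along finite words -/

section Words

variable {m : ℕ} (A : Fin m → GL (Fin 2) ℝ)

/-- The product along a word, as an invertible matrix. -/
def wordGL {n : ℕ} (w : Fin n → Fin m) : GL (Fin 2) ℝ := (List.ofFn fun k => A (w k)).prod

theorem coe_wordGL {n : ℕ} (w : Fin n → Fin m) :
    ((wordGL A w : GL (Fin 2) ℝ) : Matrix (Fin 2) (Fin 2) ℝ) = wordProd A w := rfl

theorem wordGL_zero (w : Fin 0 → Fin m) : wordGL A w = 1 := by simp [wordGL]

theorem wordGL_succ {n : ℕ} (w : Fin (n + 1) → Fin m) :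
    wordGL A w = A (w 0) * wordGL A (fun k => w k.succ) := by
  simp [wordGL, List.ofFn_succ]

theorem wordGL_succ_last {n : ℕ} (w : Fin (n + 1) → Fin m) :
    wordGL A w = wordGL A (fun k => w k.castSucc) * A (w (Fin.last n)) := by
  simp only [wordGL, List.ofFn_succ_last, List.prod_append, List.prod_singleton]

theorem wordProd_zero (w : Fin 0 → Fin m) : wordProd A w = 1 := by
  rw [← coe_wordGL, wordGL_zero]; rfl

theorem wordProd_succ {n : ℕ} (w : Fin (n + 1) → Fin m) :
    wordProd A w = A (w 0) * wordProd A (fun k => w k.succ) := by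
  rw [← coe_wordGL, wordGL_succ]; rfl

theorem wordProd_succ_last {n : ℕ} (w : Fin (n + 1) → Fin m) :
    wordProd A w = wordProd A (fun k => w k.castSucc) * A (w (Fin.last n)) := by
  rw [← coe_wordGL, wordGL_succ_last]; rfl

theorem sv₁_wordProd_pos {n : ℕ} (w : Fin n → Fin m) : 0 < sv₁ (wordProd A w) :=
  sv₁_pos (wordGL A w)

theorem sv₂_wordProd_pos {n : ℕ} (w : Fin n → Fin m) : 0 < sv₂ (wordProd A w) :=
  sv₂_pos (wordGL A w)

theorem sv₁_wordProd_le {ρ : ℝ} (hρ : ∀ i, sv₁ (A i : Matrix (Fin 2) (Fin 2) ℝ) ≤ ρ) {n : ℕ}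
    (w : Fin n → Fin m) : sv₁ (wordProd A w) ≤ ρ ^ n := by
  induction n with
  | zero => simp [wordProd_zero, sv₁_one]
  | succ n ih =>
    rw [wordProd_succ, pow_succ']
    exact (sv₁_mul_le _ _).trans (mul_le_mul (hρ _) (ih _) (sv₁_nonneg _)
      ((sv₁_nonneg _).trans (hρ (w 0))))

theorem le_sv₂_wordProd {κ : ℝ} (hκ : 0 ≤ κ)
    (h : ∀ i, κ ≤ sv₂ (A i : Matrix (Fin 2) (Fin 2) ℝ)) {n : ℕ}
    (w : Fin n → Fin m) : κ ^ n ≤ sv₂ (wordProd A w) := by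
  induction n with
  | zero => simp [wordProd_zero, sv₂_one]
  | succ n ih =>
    rw [wordProd_succ, pow_succ']
    exact (mul_le_mul (h _) (ih _) (pow_nonneg hκ n) (sv₂_nonneg _)).trans (mul_sv₂_le _ _)

end Words

/-! ### Entropy of finite-valued random variables -/

/-- The Shannon entropy of a random variable with finitely many values. -/
def rvEntropy {Ω α : Type*} [MeasurableSpace Ω] [Fintype α] (μ : Measure Ω) (X : Ω → α) : ℝ :=
  ∑ x, Real.negMulLog (μ.real (X ⁻¹' {x}))

/-- **Gibbs' inequality**: entropy is at most the cross entropy with respect to a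
sub-probability vector. -/
theorem sum_negMulLog_le {ι : Type*} [Fintype ι] (p q : ι → ℝ) (hp : ∀ i, 0 ≤ p i)
    (hq : ∀ i, 0 ≤ q i) (hpq : ∀ i, p i ≠ 0 → q i ≠ 0) (hsum : ∑ i, q i ≤ ∑ i, p i) :
    ∑ i, Real.negMulLog (p i) ≤ ∑ i, p i * -Real.log (q i) := by
  have key : ∀ i, Real.negMulLog (p i) - p i * -Real.log (q i) ≤ q i - p i := by
    intro i
    rcases eq_or_ne (p i) 0 with h | h
    · simp [h, hq i]
    have hp' : 0 < p i := lt_of_le_of_ne (hp i) h.symm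
    have hq' : 0 < q i := lt_of_le_of_ne (hq i) (hpq i h).symm
    have h1 := Real.log_le_sub_one_of_pos (div_pos hq' hp')
    rw [Real.log_div hq'.ne' h] at h1
    have h2 := mul_le_mul_of_nonneg_left h1 hp'.le
    rw [mul_sub (p i) (q i / p i), mul_div_cancel₀ _ h] at h2
    simp only [Real.negMulLog]
    linarith
  have := Finset.sum_le_sum fun i (_ : i ∈ Finset.univ) => key i
  rw [Finset.sum_sub_distrib, Finset.sum_sub_distrib] at this
  linarith

section RandomVariables

variable {Ω α β : Type*} [MeasurableSpace Ω] [Fintype α] [Fintype β] [MeasurableSpace α]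
  [MeasurableSingletonClass α] [MeasurableSpace β] [MeasurableSingletonClass β]
  (μ : Measure Ω) [IsProbabilityMeasure μ]

theorem integral_comp_eq_sum {X : Ω → α} (hX : Measurable X) (g : α → ℝ) :
    ∫ a, g (X a) ∂μ = ∑ x, μ.real (X ⁻¹' {x}) * g x := by
  have := Measure.isProbabilityMeasure_map (μ := μ) hX.aemeasurable
  rw [← integral_map hX.aemeasurable (f := g) (measurable_of_finite g).aestronglyMeasurable,
    integral_fintype (Integrable.of_finite)]
  simp [map_measureReal_apply hX (measurableSet_singleton _)]

theorem sum_measureReal_fiber {X : Ω → α} (hX : Measurable X) :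
    ∑ x, μ.real (X ⁻¹' {x}) = 1 := by
  have := integral_comp_eq_sum μ hX (fun _ => 1)
  simpa using this.symm

theorem rvEntropy_le_sum {X : Ω → α} (hX : Measurable X) (q : α → ℝ) (hq : ∀ x, 0 ≤ q x)
    (hpq : ∀ x, μ.real (X ⁻¹' {x}) ≠ 0 → q x ≠ 0) (hsum : ∑ x, q x ≤ 1) :
    rvEntropy μ X ≤ ∑ x, μ.real (X ⁻¹' {x}) * -Real.log (q x) :=
  sum_negMulLog_le _ q (fun _ => measureReal_nonneg) hq hpq
    (by rwa [sum_measureReal_fiber μ hX])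

theorem rvEntropy_eq_integral {X : Ω → α} (hX : Measurable X) :
    rvEntropy μ X = ∫ a, -Real.log (μ.real (X ⁻¹' {X a})) ∂μ := by
  rw [integral_comp_eq_sum μ hX fun x => -Real.log (μ.real (X ⁻¹' {x}))]
  simp [rvEntropy, Real.negMulLog]

/-- A function of a random variable has at most its entropy. -/
theorem rvEntropy_comp_le {X : Ω → α} (hX : Measurable X) (f : α → β) :
    rvEntropy μ (f ∘ X) ≤ rvEntropy μ X := by
  have hf : Measurable f := measurable_of_finite f
  rw [rvEntropy_eq_integral μ (hf.comp hX)]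
  have h := integral_comp_eq_sum μ hX fun x => -Real.log (μ.real ((f ∘ X) ⁻¹' {f x}))
  simp only [Function.comp_apply] at h ⊢
  rw [h]
  refine Finset.sum_le_sum fun x _ => ?_
  rcases eq_or_ne (μ.real (X ⁻¹' {x})) 0 with h0 | h0
  · simp [h0]
  have hpos : 0 < μ.real (X ⁻¹' {x}) := lt_of_le_of_ne measureReal_nonneg h0.symm
  have hle : μ.real (X ⁻¹' {x}) ≤ μ.real ((f ∘ X) ⁻¹' {f x}) := by
    refine measureReal_mono ?_
    intro a ha
    have : X a = x := ha
    simp [this]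
  have := Real.log_le_log hpos hle
  simp only [Real.negMulLog]
  nlinarith

end RandomVariables

theorem rvEntropy_nonneg {Ω α : Type*} [MeasurableSpace Ω] [Fintype α] (μ : Measure Ω)
    [IsProbabilityMeasure μ] (X : Ω → α) : 0 ≤ rvEntropy μ X :=
  Finset.sum_nonneg fun _ _ => Real.negMulLog_nonneg measureReal_nonneg measureReal_le_one

theorem joinEntropy_eq_rvEntropy {Ω : Type*} [MeasurableSpace Ω] (T : Ω → Ω) (μ : Measure Ω)
    {k : ℕ} (ξ : Ω → Fin k) (n : ℕ) :
    joinEntropy T μ ξ n = rvEntropy μ fun x (j : Fin n) => ξ (T^[j] x) := by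
  unfold joinEntropy rvEntropy
  congr! 4 with w
  ext x
  simp [funext_iff]

/-! ### The generator of the shift -/

section Shift

variable {m : ℕ}

theorem leftShift_iterate (j : ℕ) (a : ℕ → Fin m) : leftShift^[j] a = fun n => a (n + j) := by
  induction j generalizing a with
  | zero => rfl
  | succ j ih =>
    rw [Function.iterate_succ_apply, ih]
    funext n
    simp only [leftShift]
    congr 1

theorem measurable_initialWord (n : ℕ) :
    Measurable fun a : ℕ → Fin m => initialWord a n :=
  measurable_pi_lambda _ fun _ => measurable_pi_apply _

variable (μ : Measure (ℕ → Fin m)) [IsProbabilityMeasure μ]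

/-- The entropy of the partition into cylinders of length `n`. -/
def wordEntropy (μ : Measure (ℕ → Fin m)) (n : ℕ) : ℝ := rvEntropy μ fun a => initialWord a n

/-- Entropy of cylinder partitions is subadditive: compare with the product of the marginals. -/
theorem wordEntropy_add_le (hμ : MeasurePreserving leftShift μ μ) (n₁ n₂ : ℕ) :
    wordEntropy μ (n₁ + n₂) ≤ wordEntropy μ n₁ + wordEntropy μ n₂ := by
  set P : ∀ n, (Fin n → Fin m) → ℝ := fun n w => μ.real ((fun a => initialWord a n) ⁻¹' {w})
    with hP
  have hZ := measurable_initialWord (m := m) (n₁ + n₂)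
  have hmono₁ : ∀ z : Fin (n₁ + n₂) → Fin m, P _ z ≤ P n₁ (fun i => z (Fin.castAdd n₂ i)) := by
    intro z
    refine measureReal_mono fun a ha => ?_
    have : initialWord a (n₁ + n₂) = z := ha
    subst this; rfl
  have hshift : MeasurePreserving (leftShift^[n₁]) μ μ := hμ.iterate n₁
  have hw : ∀ a : ℕ → Fin m, initialWord (leftShift^[n₁] a) n₂ =
      fun i => initialWord a (n₁ + n₂) (Fin.natAdd n₁ i) := by
    intro a
    funext i
    simp [initialWord, leftShift_iterate, add_comm]
  have hmono₂ : ∀ z : Fin (n₁ + n₂) → Fin m, P _ z ≤ P n₂ (fun i => z (Fin.natAdd n₁ i)) := by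
    intro z
    have h2 : P n₂ (fun i => z (Fin.natAdd n₁ i)) = μ.real (leftShift^[n₁] ⁻¹'
        ((fun a => initialWord a n₂) ⁻¹' {fun i => z (Fin.natAdd n₁ i)})) :=
      (hshift.measureReal_preimage
        (measurable_initialWord n₂ (measurableSet_singleton _)).nullMeasurableSet).symm
    rw [h2]
    refine measureReal_mono fun a ha => ?_
    have : initialWord a (n₁ + n₂) = z := ha
    subst this
    exact hw a
  have hle := rvEntropy_le_sum μ hZ
    (fun z => P n₁ (fun i => z (Fin.castAdd n₂ i)) * P n₂ (fun i => z (Fin.natAdd n₁ i)))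
    (fun z => mul_nonneg measureReal_nonneg measureReal_nonneg)
    (fun z hz => by
      have hz' : 0 < P _ z := lt_of_le_of_ne measureReal_nonneg (Ne.symm hz)
      exact (mul_pos (hz'.trans_le (hmono₁ z)) (hz'.trans_le (hmono₂ z))).ne')
    (by
      rw [← (Fin.appendEquiv n₁ n₂).sum_comp, Fintype.sum_prod_type]
      simp only [Fin.appendEquiv, Equiv.coe_fn_mk, Fin.append_left, Fin.append_right]
      simp_rw [← Finset.mul_sum]
      rw [sum_measureReal_fiber μ (measurable_initialWord n₂)]
      simp only [mul_one]
      rw [sum_measureReal_fiber μ (measurable_initialWord n₁)])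
  refine hle.trans_eq ?_
  have h1 : wordEntropy μ n₁ = ∑ z : Fin (n₁ + n₂) → Fin m,
      P _ z * -Real.log (P n₁ (fun i => z (Fin.castAdd n₂ i))) := by
    rw [wordEntropy, rvEntropy_eq_integral μ (measurable_initialWord n₁),
      ← integral_comp_eq_sum μ hZ]
    rfl
  have h2 : wordEntropy μ n₂ = ∑ z : Fin (n₁ + n₂) → Fin m,
      P _ z * -Real.log (P n₂ (fun i => z (Fin.natAdd n₁ i))) := by
    rw [wordEntropy, rvEntropy_eq_integral μ (measurable_initialWord n₂),
      ← integral_comp_eq_sum μ hZ (fun z => -Real.log (P n₂ (fun i => z (Fin.natAdd n₁ i))))]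
    have hm : Measurable fun a : ℕ → Fin m => -Real.log (P n₂ (initialWord a n₂)) :=
      (measurable_of_finite fun z => -Real.log (P n₂ z)).comp (measurable_initialWord n₂)
    have h3 := integral_map (μ := μ) hshift.measurable.aemeasurable
      (f := fun a : ℕ → Fin m => -Real.log (P n₂ (initialWord a n₂))) (by
        rw [hshift.map_eq]; exact hm.aestronglyMeasurable)
    rw [hshift.map_eq] at h3
    simp only [hw] at h3
    exact h3
  rw [h1, h2, ← Finset.sum_add_distrib]
  refine Finset.sum_congr rfl fun z _ => ?_
  change P _ z * _ = _
  rcases eq_or_ne (P _ z) 0 with h | h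
  · simp [h]
  have hz' : 0 < P _ z := lt_of_le_of_ne measureReal_nonneg (Ne.symm h)
  rw [Real.log_mul (hz'.trans_le (hmono₁ z)).ne' (hz'.trans_le (hmono₂ z)).ne']
  ring

/-- If a finite partition `ξ` agrees with a function of the first `N` letters off a set of
measure `δ`, then its entropy exceeds that of the cylinder partition by at most a small rate. -/
theorem joinEntropy_le_wordEntropy_add (hμ : MeasurePreserving leftShift μ μ) {k N : ℕ}
    {ξ : (ℕ → Fin m) → Fin k} (hξ : Measurable ξ) (η : (Fin N → Fin m) → Fin k) {δ : ℝ}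
    (hδ₀ : 0 < δ) (hδ₁ : δ < 1) (hδ : μ.real {a | ξ a ≠ η (initialWord a N)} ≤ δ) (n : ℕ) :
    joinEntropy leftShift μ ξ n ≤
      wordEntropy μ (n + N) + n * (-Real.log (1 - δ) + δ * -Real.log (δ / k)) := by
  have hk : 0 < k := by
    obtain ⟨a⟩ := nonempty_of_isProbabilityMeasure μ
    exact Fin.pos (ξ a)
  have hk' : (1 : ℝ) ≤ k := by exact_mod_cast hk
  -- `κ i j` is a smoothed version of the kernel `if i = j then 1 else 0`
  set κ : Fin k → Fin k → ℝ := fun i j => if i = j then 1 - δ else δ / k with hκ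
  have hκpos : ∀ i j, 0 < κ i j := by
    intro i j
    simp only [hκ]
    split_ifs
    · linarith
    · positivity
  have hκsum : ∀ j, ∑ i, κ i j ≤ 1 := by
    intro j
    have h1 : ∀ i, κ i j ≤ δ / k + if i = j then 1 - δ else 0 := by
      intro i
      simp only [hκ]
      split_ifs
      · have : 0 < δ / k := by positivity
        linarith
      · simp
    refine (Finset.sum_le_sum fun i _ => h1 i).trans ?_
    rw [Finset.sum_add_distrib]
    simp
    field_simp
    linarith
  set Z : (ℕ → Fin m) → Fin (n + N) → Fin m := fun a => initialWord a (n + N) with hZdef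
  set W : (ℕ → Fin m) → Fin n → Fin k := fun a j => ξ (leftShift^[j] a) with hWdef
  set sub : Fin n → (Fin (n + N) → Fin m) → Fin N → Fin m :=
    fun j z i => z ⟨i + j, by omega⟩ with hsub
  have hZ : Measurable Z := measurable_initialWord _
  have hσ : ∀ j : ℕ, MeasurePreserving (leftShift^[j]) μ μ := fun j => hμ.iterate j
  have hW : Measurable W := measurable_pi_lambda _ fun j => hξ.comp (hσ j).measurable
  have hWZ : Measurable fun a => (W a, Z a) := hW.prodMk hZ
  set P : (Fin (n + N) → Fin m) → ℝ := fun z => μ.real (Z ⁻¹' {z}) with hP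
  set p : (Fin n → Fin k) × (Fin (n + N) → Fin m) → ℝ :=
    fun x => μ.real ((fun a => (W a, Z a)) ⁻¹' {x}) with hp
  have hpP : ∀ x, p x ≤ P x.2 := by
    intro x
    refine measureReal_mono fun a ha => ?_
    have : (W a, Z a) = x := ha
    subst this; rfl
  set K : (Fin n → Fin k) × (Fin (n + N) → Fin m) → ℝ :=
    fun x => ∏ j, κ (x.1 j) (η (sub j x.2)) with hK
  have hKpos : ∀ x, 0 < K x := fun x => Finset.prod_pos fun j _ => hκpos _ _
  have h0 : joinEntropy leftShift μ ξ n ≤ rvEntropy μ fun a => (W a, Z a) := by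
    rw [joinEntropy_eq_rvEntropy]
    exact rvEntropy_comp_le μ hWZ Prod.fst
  have h1 := rvEntropy_le_sum μ hWZ (fun x => P x.2 * K x)
    (fun x => mul_nonneg measureReal_nonneg (hKpos x).le)
    (fun x hx => by
      have hx' : 0 < p x := lt_of_le_of_ne measureReal_nonneg (Ne.symm hx)
      exact (mul_pos (hx'.trans_le (hpP x)) (hKpos x)).ne')
    (by
      rw [Fintype.sum_prod_type_right]
      simp_rw [← Finset.mul_sum]
      calc ∑ z, P z * ∑ w, K (w, z) ≤ ∑ z, P z * 1 := by
            refine Finset.sum_le_sum fun z _ =>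
              mul_le_mul_of_nonneg_left ?_ measureReal_nonneg
            have : ∑ w, K (w, z) = ∏ j : Fin n, ∑ i, κ i (η (sub j z)) := by
              rw [Finset.prod_univ_sum, Fintype.piFinset_univ]
            rw [this]
            exact Finset.prod_le_one (fun j _ => Finset.sum_nonneg fun i _ => (hκpos _ _).le)
              fun j _ => hκsum _
        _ = 1 := by simpa using sum_measureReal_fiber μ hZ)
  have h2 : ∑ x, p x * -Real.log (P x.2 * K x) =
      ∑ x, p x * -Real.log (P x.2) + ∑ j : Fin n, ∑ x, p x *
        -Real.log (κ (x.1 j) (η (sub j x.2))) := by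
    rw [Finset.sum_comm, ← Finset.sum_add_distrib]
    refine Finset.sum_congr rfl fun x _ => ?_
    rcases eq_or_ne (p x) 0 with h | h
    · simp [h]
    have hx' : 0 < p x := lt_of_le_of_ne measureReal_nonneg (Ne.symm h)
    rw [Real.log_mul (hx'.trans_le (hpP x)).ne' (hKpos x).ne', hK,
      Real.log_prod (fun j _ => (hκpos _ _).ne'), ← Finset.mul_sum, Finset.sum_neg_distrib]
    ring
  have h3 : ∑ x, p x * -Real.log (P x.2) = wordEntropy μ (n + N) := by
    rw [wordEntropy, rvEntropy_eq_integral μ (measurable_initialWord (n + N)),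
      ← integral_comp_eq_sum μ hWZ (fun x => -Real.log (P x.2))]
  have h4 : ∀ j : Fin n, ∑ x, p x * -Real.log (κ (x.1 j) (η (sub j x.2))) ≤
      -Real.log (1 - δ) + δ * -Real.log (δ / k) := by
    intro j
    rw [← integral_comp_eq_sum μ hWZ (fun x => -Real.log (κ (x.1 j) (η (sub j x.2))))]
    set F : (ℕ → Fin m) → ℝ := fun a => -Real.log (κ (ξ a) (η (initialWord a N))) with hF
    have hFm : Measurable F := by
      have : Measurable fun a => (ξ a, initialWord a N) :=
        hξ.prodMk (measurable_initialWord N)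
      exact (measurable_of_finite fun x : Fin k × (Fin N → Fin m) =>
        -Real.log (κ x.1 (η x.2))).comp this
    have h5 : ∫ a, F (leftShift^[j] a) ∂μ = ∫ a, F a ∂μ := by
      have h3 := integral_map (μ := μ) (hσ j).measurable.aemeasurable (f := F) (by
          rw [(hσ j).map_eq]; exact hFm.aestronglyMeasurable)
      rw [(hσ j).map_eq] at h3
      exact h3.symm
    have h6 : ∀ a, F (leftShift^[j] a) =
        -Real.log (κ (W a j) (η (sub j (Z a)))) := by
      intro a
      have : initialWord (leftShift^[j] a) N = sub j (Z a) := by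
        funext i
        simp [initialWord, leftShift_iterate, hsub, hZdef]
      simp only [hF, this, hWdef]
    simp only [← h6]
    rw [h5]
    set D : Set (ℕ → Fin m) := {a | ξ a ≠ η (initialWord a N)} with hD
    have hDm : MeasurableSet D :=
      (measurableSet_eq_fun hξ ((measurable_of_finite η).comp (measurable_initialWord N))).compl
    have hlog₁ : 0 ≤ -Real.log (1 - δ) :=
      neg_nonneg.2 (Real.log_nonpos (by linarith) (by linarith))
    have hlog₂ : 0 ≤ -Real.log (δ / k) := by
      refine neg_nonneg.2 (Real.log_nonpos (by positivity) ?_)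
      rw [div_le_one (by positivity)]
      linarith
    calc ∫ a, F a ∂μ ≤
        ∫ a, (-Real.log (1 - δ) + D.indicator (fun _ => -Real.log (δ / k)) a) ∂μ := by
          refine integral_mono_of_nonneg ?_ ?_ ?_
          · refine Eventually.of_forall fun a => neg_nonneg.2
              (Real.log_nonpos (hκpos _ _).le ?_)
            exact (Finset.single_le_sum (fun i _ => (hκpos i _).le)
              (Finset.mem_univ (ξ a))).trans (hκsum _)
          · exact (integrable_const _).add ((integrable_const _).indicator hDm)
          · refine Eventually.of_forall fun a => ?_
            by_cases ha : ξ a = η (initialWord a N)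
            · have : a ∉ D := fun h => h ha
              simp [hF, hκ, ha, this]
            · have : a ∈ D := ha
              simp [hF, hκ, ha, this]
              simpa using hlog₁
      _ = -Real.log (1 - δ) + μ.real D * -Real.log (δ / k) := by
          rw [integral_add (integrable_const _) ((integrable_const _).indicator hDm),
            integral_indicator_const _ hDm]
          simp
      _ ≤ _ := by gcongr
  calc joinEntropy leftShift μ ξ n ≤ _ := h0
    _ ≤ _ := h1
    _ = _ := h2
    _ ≤ wordEntropy μ (n + N) + ∑ j : Fin n, (-Real.log (1 - δ) + δ * -Real.log (δ / k)) := by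
        rw [h3]
        exact add_le_add_right (Finset.sum_le_sum fun j _ => h4 j) _
    _ = _ := by rw [Finset.sum_const, Finset.card_univ, Fintype.card_fin, nsmul_eq_mul]

/-- Every finite measurable partition of the sequence space is approximated by functions of
finitely many letters. -/
theorem exists_cylinder_approx {k : ℕ} {ξ : (ℕ → Fin m) → Fin k} (hξ : Measurable ξ) {δ : ℝ}
    (hδ : 0 < δ) : ∃ (N : ℕ) (η : (Fin N → Fin m) → Fin k),
      μ.real {a | ξ a ≠ η (initialWord a N)} ≤ δ := by
  obtain ⟨a₀⟩ := nonempty_of_isProbabilityMeasure μ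
  have hk : 0 < k := Fin.pos (ξ a₀)
  have hk' : (0 : ℝ) < k := by exact_mod_cast hk
  have hdense := Measure.MeasureDense.of_generateFrom_isSetAlgebra_finite μ
    (isSetAlgebra_measurableCylinders (α := fun _ : ℕ => Fin m))
    generateFrom_measurableCylinders.symm
  have happ := fun i : Fin k => hdense.approx (ξ ⁻¹' {i}) (hξ (measurableSet_singleton i))
    (measure_ne_top μ _) (δ / k) (by positivity)
  choose t ht htδ using happ
  have ht' := fun i => (mem_measurableCylinders (t i)).1 (ht i)
  choose s S hS htS using ht'
  obtain ⟨N, hN⟩ : ∃ N : ℕ, ∀ i, ∀ l ∈ s i, l < N := by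
    refine ⟨(Finset.univ.biUnion s).sup id + 1, fun i l hl => Nat.lt_succ_of_le ?_⟩
    exact Finset.le_sup (f := id) (Finset.mem_biUnion.2 ⟨i, Finset.mem_univ i, hl⟩)
  set ext : (Fin N → Fin m) → ℕ → Fin m :=
    fun u l => if h : l < N then u ⟨l, h⟩ else a₀ l with hext
  have hmem : ∀ a i, ext (initialWord a N) ∈ t i ↔ a ∈ t i := by
    intro a i
    rw [htS i, mem_cylinder, mem_cylinder]
    have : (s i).restrict (ext (initialWord a N)) = (s i).restrict a := by
      funext l
      have := hN i l l.2
      simp [hext, this, initialWord]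
    rw [this]
  classical
  refine ⟨N, fun u => if h : ∃ i, ext u ∈ t i then h.choose else ξ (ext u), ?_⟩
  have hsub : {a | ξ a ≠ (if h : ∃ i, ext (initialWord a N) ∈ t i then h.choose else
      ξ (ext (initialWord a N)))} ⊆ ⋃ i, symmDiff (ξ ⁻¹' {i}) (t i) := by
    intro a ha
    by_contra hcon
    simp only [Set.mem_iUnion, not_exists, Set.mem_symmDiff, not_or, not_and, not_not] at hcon
    have h1 : ∃ i, ext (initialWord a N) ∈ t i := ⟨ξ a, (hmem _ _).2 ((hcon (ξ a)).1 rfl)⟩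
    refine ha ?_
    rw [dif_pos h1]
    exact (hcon _).2 ((hmem _ _).1 h1.choose_spec)
  calc μ.real _ ≤ μ.real (⋃ i, symmDiff (ξ ⁻¹' {i}) (t i)) := measureReal_mono hsub
    _ ≤ ∑ i, μ.real (symmDiff (ξ ⁻¹' {i}) (t i)) := measureReal_iUnion_fintype_le _
    _ ≤ ∑ i : Fin k, δ / k := by
        refine Finset.sum_le_sum fun i _ => ?_
        exact ENNReal.toReal_le_of_le_ofReal (by positivity) (htδ i).le
    _ = δ := by simp; field_simp

/-- One half of the **Kolmogorov–Sinai theorem**: the cylinder partition has full entropy.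
Together with subadditivity this bounds the entropy of every finite cylinder partition below. -/
theorem mul_ksEntropy_le_wordEntropy (hμ : MeasurePreserving leftShift μ μ) {h : ℝ}
    (hh : ksEntropy leftShift μ = (h : EReal)) (n : ℕ) : n * h ≤ wordEntropy μ n := by
  have hsub : Subadditive (wordEntropy μ) := wordEntropy_add_le μ hμ
  have hbdd : BddBelow (Set.range fun n => wordEntropy μ n / n) := by
    refine ⟨0, ?_⟩
    rintro _ ⟨n, rfl⟩
    exact div_nonneg (rvEntropy_nonneg μ _) (Nat.cast_nonneg n)
  have hlim := hsub.tendsto_lim hbdd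
  rcases Nat.eq_zero_or_pos n with rfl | hn
  · rw [Nat.cast_zero, zero_mul]
    exact rvEntropy_nonneg μ _
  suffices hle : h ≤ hsub.lim by
    have h1 := hle.trans (hsub.lim_le_div hbdd hn.ne')
    rw [le_div_iff₀ (by exact_mod_cast hn)] at h1
    linarith
  refine le_of_forall_pos_le_add fun ε hε => ?_
  rw [← EReal.coe_le_coe_iff, ← hh]
  refine iSup_le fun k => iSup_le fun ξ => iSup_le fun hξ => ?_
  have hδ : ∃ δ : ℝ, 0 < δ ∧ δ < 1 ∧ -Real.log (1 - δ) + δ * -Real.log (δ / k) < ε := by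
    have hcont : Tendsto (fun δ : ℝ => -Real.log (1 - δ) +
        (Real.negMulLog δ + δ * Real.log k)) (𝓝[>] 0) (𝓝 0) := by
      have h1 : ContinuousAt (fun δ : ℝ => -Real.log (1 - δ) +
        (Real.negMulLog δ + δ * Real.log k)) 0 := by
        refine ContinuousAt.add (ContinuousAt.neg (ContinuousAt.log (by fun_prop) (by simp))) ?_
        exact (Real.continuous_negMulLog.continuousAt).add (by fun_prop)
      have h2 := h1.tendsto
      simp only [sub_zero, Real.log_one, neg_zero, Real.negMulLog_zero, zero_mul, add_zero] at h2
      exact h2.mono_left nhdsWithin_le_nhds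
    have hev := (hcont.eventually (gt_mem_nhds hε)).and
      (Ioo_mem_nhdsGT (zero_lt_one (α := ℝ)))
    obtain ⟨δ, h1, h2⟩ := hev.exists
    refine ⟨δ, h2.1, h2.2, ?_⟩
    have hk : (0 : ℝ) < k := by
      obtain ⟨a⟩ := nonempty_of_isProbabilityMeasure μ
      exact_mod_cast Fin.pos (ξ a)
    rw [Real.log_div h2.1.ne' hk.ne']
    simp only [Real.negMulLog] at h1
    linarith
  obtain ⟨δ, hδ₀, hδ₁, hδε⟩ := hδ
  obtain ⟨N, η, hη⟩ := exists_cylinder_approx μ hξ hδ₀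
  have hbound := joinEntropy_le_wordEntropy_add μ hμ hξ η hδ₀ hδ₁ hη
  have hlim2 : Tendsto (fun n : ℕ => wordEntropy μ (n + N) / n + ε) atTop
      (𝓝 (hsub.lim + ε)) := by
    refine Tendsto.add_const ε ?_
    have h1 : Tendsto (fun n : ℕ => wordEntropy μ (n + N) / ((n + N : ℕ) : ℝ)) atTop
        (𝓝 hsub.lim) := hlim.comp (tendsto_add_atTop_nat N)
    have h2 : Tendsto (fun n : ℕ => ((n + N : ℕ) : ℝ) / n) atTop (𝓝 1) := by
      have h3 : Tendsto (fun n : ℕ => 1 + (N : ℝ) / n) atTop (𝓝 (1 + 0)) :=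
        tendsto_const_nhds.add (tendsto_const_div_atTop_nhds_zero_nat _)
      rw [add_zero] at h3
      refine h3.congr' ?_
      filter_upwards [eventually_gt_atTop 0] with n hn
      have : (n : ℝ) ≠ 0 := by exact_mod_cast hn.ne'
      push_cast
      field_simp
    have h4 := h1.mul h2
    rw [mul_one] at h4
    refine h4.congr' ?_
    filter_upwards [eventually_gt_atTop 0] with n hn
    have : (n : ℝ) ≠ 0 := by exact_mod_cast hn.ne'
    have : ((n + N : ℕ) : ℝ) ≠ 0 := by positivity
    field_simp
  have hlim3 : Tendsto (fun n : ℕ => ((wordEntropy μ (n + N) / n + ε : ℝ) : EReal)) atTop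
      (𝓝 ((hsub.lim + ε : ℝ) : EReal)) := (continuous_coe_real_ereal.tendsto _).comp hlim2
  rw [← hlim3.limsup_eq]
  refine limsup_le_limsup ?_
  filter_upwards [eventually_gt_atTop 0] with n hn
  rw [EReal.coe_le_coe_iff]
  have hn' : (0 : ℝ) < n := by exact_mod_cast hn
  rw [div_add' _ _ _ hn'.ne']
  refine div_le_div_of_nonneg_right ((hbound n).trans ?_) hn'.le
  nlinarith

end Shift

/-! ### The topology of the projective line -/

/-- The line spanned by a nonzero vector. -/
def lineOf (v : {v : Fin 2 → ℝ // v ≠ 0}) : RP1 := Projectivization.mk ℝ v.1 v.2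

theorem isQuotientMap_lineOf : IsQuotientMap lineOf :=
  ⟨⟨rfl⟩, fun θ => ⟨⟨θ.rep, θ.rep_nonzero⟩, θ.mk_rep⟩⟩

theorem continuous_coord (i : Fin 2) :
    Continuous fun v : {v : Fin 2 → ℝ // v ≠ 0} => v.1 i :=
  (continuous_apply i).comp continuous_subtype_val

theorem sq_add_sq_pos {v : Fin 2 → ℝ} (hv : v ≠ 0) : 0 < v 0 ^ 2 + v 1 ^ 2 := by
  by_contra h
  refine hv ?_
  have h0 : v 0 = 0 := by nlinarith [sq_nonneg (v 0), sq_nonneg (v 1)]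
  have h1 : v 1 = 0 := by nlinarith [sq_nonneg (v 0), sq_nonneg (v 1)]
  funext i
  fin_cases i <;> simp [h0, h1]

/-- The doubled-angle embedding of the projective line into the plane. -/
def doubleAngle : RP1 → ℝ × ℝ :=
  Projectivization.lift (fun v => ((v.1 0 ^ 2 - v.1 1 ^ 2) / (v.1 0 ^ 2 + v.1 1 ^ 2),
    2 * v.1 0 * v.1 1 / (v.1 0 ^ 2 + v.1 1 ^ 2))) <| by
    rintro ⟨a, ha⟩ ⟨b, hb⟩ t h
    simp only at h
    have ht : t ≠ 0 := by
      rintro rfl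
      exact ha (by simp [h])
    have hb' := (sq_add_sq_pos hb).ne'
    subst h
    have h3 : (t • b) 0 ^ 2 + (t • b) 1 ^ 2 = t ^ 2 * (b 0 ^ 2 + b 1 ^ 2) := by
      simp only [Pi.smul_apply, smul_eq_mul]; ring
    simp only [h3, Prod.mk.injEq]
    simp only [Pi.smul_apply, smul_eq_mul]
    constructor <;> field_simp

theorem continuous_doubleAngle : Continuous doubleAngle := by
  rw [isQuotientMap_lineOf.continuous_iff]
  have h : ∀ v : {v : Fin 2 → ℝ // v ≠ 0}, v.1 0 ^ 2 + v.1 1 ^ 2 ≠ 0 :=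
    fun v => (sq_add_sq_pos v.2).ne'
  change Continuous fun v : {v : Fin 2 → ℝ // v ≠ 0} =>
    ((v.1 0 ^ 2 - v.1 1 ^ 2) / (v.1 0 ^ 2 + v.1 1 ^ 2),
    2 * v.1 0 * v.1 1 / (v.1 0 ^ 2 + v.1 1 ^ 2))
  have h0 := continuous_coord 0
  have h1 := continuous_coord 1
  refine Continuous.prodMk (Continuous.div ?_ ?_ h) (Continuous.div ?_ ?_ h)
  exacts [(h0.pow 2).sub (h1.pow 2), (h0.pow 2).add (h1.pow 2),
    (continuous_const.mul h0).mul h1, (h0.pow 2).add (h1.pow 2)]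

theorem injective_doubleAngle : Function.Injective doubleAngle := by
  intro θ₁ θ₂
  induction θ₁ using Projectivization.ind with | h v hv => ?_
  induction θ₂ using Projectivization.ind with | h w hw => ?_
  intro h
  change ((v 0 ^ 2 - v 1 ^ 2) / (v 0 ^ 2 + v 1 ^ 2), 2 * v 0 * v 1 / (v 0 ^ 2 + v 1 ^ 2)) =
    ((w 0 ^ 2 - w 1 ^ 2) / (w 0 ^ 2 + w 1 ^ 2), 2 * w 0 * w 1 / (w 0 ^ 2 + w 1 ^ 2)) at h
  have hv' := sq_add_sq_pos hv
  have hw' := sq_add_sq_pos hw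
  rw [Prod.mk.injEq, div_eq_div_iff hv'.ne' hw'.ne', div_eq_div_iff hv'.ne' hw'.ne'] at h
  obtain ⟨h1, h2⟩ := h
  -- the sine of the doubled angle difference vanishes, and its cosine is positive
  have hdet : v 0 * w 1 = v 1 * w 0 := by
    have e1 : (v 0 * w 1 - v 1 * w 0) * (v 0 * w 1 + v 1 * w 0) = 0 := by nlinarith
    have e2 : (v 0 * w 1 - v 1 * w 0) * (v 0 * w 0 - v 1 * w 1) = 0 := by nlinarith
    rcases mul_eq_zero.1 e1 with e | e
    · linarith
    rcases mul_eq_zero.1 e2 with e' | e'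
    · linarith
    exfalso
    have e3 : v 0 * w 1 = -(v 1 * w 0) := by linarith
    have e4 : v 0 * w 0 = v 1 * w 1 := by linarith
    have e5 : v 0 * (w 0 ^ 2 + w 1 ^ 2) = 0 := by
      calc v 0 * (w 0 ^ 2 + w 1 ^ 2) = (v 0 * w 0) * w 0 + (v 0 * w 1) * w 1 := by ring
        _ = 0 := by rw [e3, e4]; ring
    have e6 : v 1 * (w 0 ^ 2 + w 1 ^ 2) = 0 := by
      calc v 1 * (w 0 ^ 2 + w 1 ^ 2) = (v 1 * w 0) * w 0 + (v 1 * w 1) * w 1 := by ring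
        _ = 0 := by rw [← e4, show v 1 * w 0 = -(v 0 * w 1) by linarith]; ring
    rw [mul_eq_zero, or_iff_left hw'.ne'] at e5 e6
    rw [e5, e6] at hv'
    simp at hv'
  rw [Projectivization.mk_eq_mk_iff']
  refine ⟨(v 0 * w 0 + v 1 * w 1) / (w 0 ^ 2 + w 1 ^ 2), ?_⟩
  funext i
  simp only [Pi.smul_apply, smul_eq_mul]
  fin_cases i
  · simp only [Fin.zero_eta]
    rw [div_mul_eq_mul_div, div_eq_iff hw'.ne']
    linear_combination (-w 1) * hdet
  · simp only [Fin.mk_one]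
    rw [div_mul_eq_mul_div, div_eq_iff hw'.ne']
    linear_combination (w 0) * hdet

instance t2Space_RP1 : T2Space RP1 :=
  .of_injective_continuous injective_doubleAngle continuous_doubleAngle

instance compactSpace_RP1 : CompactSpace RP1 := by
  have hne : ∀ v : Metric.sphere (0 : Fin 2 → ℝ) 1, (v : Fin 2 → ℝ) ≠ 0 :=
    fun v h => by simpa [h] using v.2
  set f : Metric.sphere (0 : Fin 2 → ℝ) 1 → RP1 := fun v => lineOf ⟨v, hne v⟩ with hf
  have hcont : Continuous f :=
    isQuotientMap_lineOf.continuous.comp (Continuous.subtype_mk continuous_subtype_val hne)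
  have : CompactSpace (Metric.sphere (0 : Fin 2 → ℝ) 1) :=
    isCompact_iff_compactSpace.1 (isCompact_sphere _ _)
  refine Function.Surjective.compactSpace hcont ?_
  intro θ
  induction θ using Projectivization.ind with | h v hv => ?_
  refine ⟨⟨‖v‖⁻¹ • v, by simp [norm_smul, hv]⟩, ?_⟩
  change Projectivization.mk ℝ _ _ = _
  rw [Projectivization.mk_eq_mk_iff']
  exact ⟨_, rfl⟩

theorem mk_mem_negQuadrant {v : Fin 2 → ℝ} (hv : v ≠ 0) :
    Projectivization.mk ℝ v hv ∈ negQuadrant ↔ v 0 * v 1 ≤ 0 := by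
  obtain ⟨a, ha⟩ := Projectivization.exists_smul_eq_mk_rep ℝ v hv
  have ha0 : 0 < (a : ℝ) ^ 2 := by
    have := a.ne_zero
    positivity
  have h : (a : ℝ) ^ 2 * (v 0 * v 1) = (Projectivization.mk ℝ v hv).rep 0 *
      (Projectivization.mk ℝ v hv).rep 1 := by
    rw [← ha]
    simp only [Pi.smul_apply, Units.smul_def, smul_eq_mul]
    ring
  rw [negQuadrant, Set.mem_ofPred_eq, ← h]
  constructor
  · intro h'
    by_contra hcon
    nlinarith
  · intro h'
    nlinarith

theorem isClosed_negQuadrant : IsClosed negQuadrant := by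
  rw [← isQuotientMap_lineOf.isClosed_preimage]
  have : lineOf ⁻¹' negQuadrant = {v | v.1 0 * v.1 1 ≤ 0} := by
    ext v
    exact mk_mem_negQuadrant v.2
  rw [this]
  exact isClosed_le ((continuous_coord 0).mul (continuous_coord 1)) continuous_const

theorem continuous_smul_RP1 (g : GL (Fin 2) ℝ) : Continuous fun θ : RP1 => g • θ := by
  rw [isQuotientMap_lineOf.continuous_iff]
  have hne : ∀ v : {v : Fin 2 → ℝ // v ≠ 0},
      (g : Matrix (Fin 2) (Fin 2) ℝ) *ᵥ v.1 ≠ 0 := fun v =>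
    (smul_ne_zero_iff_ne (a := g)).mpr v.2
  change Continuous fun v : {v : Fin 2 → ℝ // v ≠ 0} =>
    lineOf ⟨(g : Matrix (Fin 2) (Fin 2) ℝ) *ᵥ v.1, hne v⟩
  exact isQuotientMap_lineOf.continuous.comp (Continuous.subtype_mk
    (Continuous.matrix_mulVec continuous_const continuous_subtype_val) hne)

/-- The inverse of a positive matrix preserves the negative quadrant. -/
theorem inv_smul_mem_negQuadrant {g : GL (Fin 2) ℝ}
    (hg : ∀ k l, 0 < (g : Matrix (Fin 2) (Fin 2) ℝ) k l) {θ : RP1} (hθ : θ ∈ negQuadrant) :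
    g⁻¹ • θ ∈ negQuadrant := by
  obtain ⟨η, rfl⟩ : ∃ η, g • η = θ := ⟨g⁻¹ • θ, smul_inv_smul g θ⟩
  rw [inv_smul_smul]
  induction η using Projectivization.ind with | h v hv => ?_
  rw [Projectivization.smul_mk, mk_mem_negQuadrant] at hθ
  rw [mk_mem_negQuadrant]
  by_contra! hcon
  refine absurd hθ (not_le.2 ?_)
  change 0 < ((g : Matrix (Fin 2) (Fin 2) ℝ) *ᵥ v) 0 * ((g : Matrix (Fin 2) (Fin 2) ℝ) *ᵥ v) 1
  simp only [Matrix.mulVec, dotProduct, Fin.sum_univ_two]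
  have h00 := hg 0 0
  have h01 := hg 0 1
  have h10 := hg 1 0
  have h11 := hg 1 1
  have p1 := mul_pos (mul_pos h00 h11) hcon
  have p2 := mul_pos (mul_pos h01 h10) hcon
  have p3 := mul_nonneg (mul_pos h00 h10).le (sq_nonneg (v 0))
  have p4 := mul_nonneg (mul_pos h01 h11).le (sq_nonneg (v 1))
  nlinarith

/-! ### Visits to closed sets of directions -/

section Visits

variable {m : ℕ} (A : Fin m → GL (Fin 2) ℝ)

theorem directionOrbit_add (a : ℕ → Fin m) (θ : RP1) (k n : ℕ) :
    directionOrbit A a θ (k + n) =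
      (wordGL A (initialWord (leftShift^[k] a) n))⁻¹ • directionOrbit A a θ k := by
  induction n with
  | zero => simp [wordGL_zero]
  | succ n ih =>
    rw [wordGL_succ_last, _root_.mul_inv_rev, mul_smul, ← add_assoc, directionOrbit, ih]
    congr 3
    simp [initialWord, leftShift_iterate, add_comm]

theorem directionOrbit_eq (a : ℕ → Fin m) (θ : RP1) (n : ℕ) :
    directionOrbit A a θ n = (wordGL A (initialWord a n))⁻¹ • θ := by
  have := directionOrbit_add A a θ 0 n
  rwa [zero_add] at this

theorem directionOrbit_mem_negQuadrant
    (hA : ∀ i k l, 0 < (A i : Matrix (Fin 2) (Fin 2) ℝ) k l) (a : ℕ → Fin m) {θ : RP1}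
    (hθ : θ ∈ negQuadrant) (n : ℕ) : directionOrbit A a θ n ∈ negQuadrant := by
  induction n with
  | zero => exact hθ
  | succ n ih => exact inv_smul_mem_negQuadrant (hA _) ih

/-- The words `w` for which `A_w⁻¹` moves some direction of the negative quadrant into `G`. -/
def visitingWords (G : Set RP1) (n : ℕ) : Set (Fin n → Fin m) :=
  {w | ∃ θ ∈ negQuadrant, (wordGL A w)⁻¹ • θ ∈ G}

/-- The Furstenberg measure of a closed set of directions is at most the probability that
`A_w⁻¹` moves some direction of the negative quadrant into it, for every length of `w`. The orbit
of a single direction need not visit the closed set, but at time `k` it lies in the image of the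
negative quadrant under the last `n` maps, and these images for non-visiting words form a compact
set disjoint from `G`, which a continuous function separates from `G`. -/
theorem measureReal_le_visitingWords
    (hA : ∀ i k l, 0 < (A i : Matrix (Fin 2) (Fin 2) ℝ) k l) (μ : Measure (ℕ → Fin m))
    [IsProbabilityMeasure μ] (hμ : MeasurePreserving leftShift μ μ) {μF : Measure RP1}
    (hμF : IsFurstenbergMeasure A μ μF) {G : Set RP1} (hG : IsClosed G) (n : ℕ) :
    μF.real G ≤ μ.real {a | initialWord a n ∈ visitingWords A G n} := by
  have := hμF.isProbabilityMeasure
  set B : Set (ℕ → Fin m) := {a | initialWord a n ∈ visitingWords A G n} with hB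
  have hBm : MeasurableSet B := measurable_initialWord n (Set.toFinite _).measurableSet
  set C : Set RP1 := ⋃ w ∈ (visitingWords A G n)ᶜ, {θ | wordGL A w • θ ∈ negQuadrant} with hC
  have hCclosed : IsClosed C := (Set.toFinite _).isClosed_biUnion fun w _ =>
    isClosed_negQuadrant.preimage (continuous_smul_RP1 _)
  have hdisj : Disjoint C G := by
    rw [Set.disjoint_left]
    intro θ hθ hθG
    simp only [hC, Set.mem_iUnion] at hθ
    obtain ⟨w, hw, hθ⟩ := hθ
    exact hw ⟨_, hθ, by rwa [inv_smul_smul]⟩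
  obtain ⟨f, hf0, hf1, hf⟩ := exists_continuous_zero_one_of_isClosed hCclosed hG hdisj
  obtain ⟨θ, hθ⟩ : negQuadrant.Nonempty :=
    ⟨Projectivization.mk ℝ ![1, 0] (by simp), (mk_mem_negQuadrant _).2 (by simp)⟩
  have horb : ∀ k, Measurable fun a => f (directionOrbit A a θ k) := by
    intro k
    simp only [directionOrbit_eq]
    exact (measurable_of_finite fun w : Fin k → Fin m => f ((wordGL A w)⁻¹ • θ)).comp
      (measurable_initialWord k)
  have hint : ∀ k, Integrable (fun a => f (directionOrbit A a θ k)) μ := fun k =>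
    Integrable.of_bound (horb k).aestronglyMeasurable 1 (Eventually.of_forall fun a => by
      rw [Real.norm_eq_abs, abs_of_nonneg (hf _).1]; exact (hf _).2)
  -- from time `n` on, the separating function is bounded by the indicator of a visit
  have hvisit : ∀ k, ∫ a, f (directionOrbit A a θ (k + n)) ∂μ ≤ μ.real B := by
    intro k
    have hσ := hμ.iterate k
    rw [← hσ.measureReal_preimage hBm.nullMeasurableSet,
      ← integral_indicator_one (hσ.measurable hBm)]
    refine integral_mono (hint _)
      ((integrable_const (1 : ℝ)).indicator (hσ.measurable hBm)) fun a => ?_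
    by_cases ha : a ∈ leftShift^[k] ⁻¹' B
    · simpa [Set.indicator_of_mem ha] using (hf (directionOrbit A a θ (k + n))).2
    · rw [Set.indicator_of_notMem ha]
      refine (hf0 ?_).le
      simp only [hC, Set.mem_iUnion]
      refine ⟨_, ha, ?_⟩
      rw [Set.mem_ofPred_eq, directionOrbit_add, smul_inv_smul]
      exact directionOrbit_mem_negQuadrant A hA a hθ k
  have hle1 : ∀ k, ∫ a, f (directionOrbit A a θ k) ∂μ ≤ 1 := by
    intro k
    have := integral_mono (hint k) (integrable_const (1 : ℝ)) fun a => (hf _).2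
    simpa using this
  have hav : ∀ N, ∑ k ∈ Finset.range N, ∫ a, f (directionOrbit A a θ k) ∂μ ≤
      n + N * μ.real B := by
    intro N
    have hterm : ∀ k ∈ Finset.range N, ∫ a, f (directionOrbit A a θ k) ∂μ ≤
        (if k < n then 1 else 0) + μ.real B := by
      intro k _
      split_ifs with h
      · exact (hle1 k).trans (le_add_of_nonneg_right measureReal_nonneg)
      · obtain ⟨l, rfl⟩ := Nat.exists_eq_add_of_le' (not_lt.1 h)
        simpa using hvisit l
    refine (Finset.sum_le_sum hterm).trans ?_
    rw [Finset.sum_add_distrib, Finset.sum_boole]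
    simp only [Finset.sum_const, Finset.card_range, nsmul_eq_mul]
    gcongr
    calc ((Finset.range N).filter (· < n)).card ≤ (Finset.range n).card :=
          Finset.card_le_card fun k hk => by simp at hk ⊢; exact hk.2
      _ = n := Finset.card_range n
  have hlim : Tendsto (fun N : ℕ => ∫ a,
      (∑ k ∈ Finset.range N, f (directionOrbit A a θ k)) / N ∂μ) atTop
      (𝓝 (∫ _, (∫ ϑ, f ϑ ∂μF) ∂μ)) := by
    refine tendsto_integral_of_dominated_convergence (fun _ => 1) (fun N => ?_)
      (integrable_const _) (fun N => Eventually.of_forall fun a => ?_) ?_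
    · exact ((Finset.measurable_sum _ fun k _ => horb k).div_const _).aestronglyMeasurable
    · rw [Real.norm_eq_abs, abs_of_nonneg (div_nonneg (Finset.sum_nonneg fun k _ => (hf _).1)
        (Nat.cast_nonneg _))]
      refine div_le_one_of_le₀ ?_ (Nat.cast_nonneg _)
      calc ∑ k ∈ Finset.range N, f (directionOrbit A a θ k) ≤ ∑ k ∈ Finset.range N, (1 : ℝ) :=
            Finset.sum_le_sum fun k _ => (hf _).2
        _ = N := by simp
    · filter_upwards [hμF.tendsto] with a ha
      exact ha θ hθ (BoundedContinuousFunction.mkOfCompact f)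
  have hG' : μF.real G ≤ ∫ ϑ, f ϑ ∂μF := by
    rw [← integral_indicator_one hG.measurableSet]
    refine integral_mono ((integrable_const (1 : ℝ)).indicator hG.measurableSet)
      ((BoundedContinuousFunction.mkOfCompact f).integrable μF) fun ϑ => ?_
    by_cases h : ϑ ∈ G
    · simp [h, hf1 h]
    · simpa [h] using (hf ϑ).1
  have hlim2 : Tendsto (fun N : ℕ => (n : ℝ) / N + μ.real B) atTop (𝓝 (0 + μ.real B)) :=
    (tendsto_const_div_atTop_nhds_zero_nat _).add tendsto_const_nhds
  rw [zero_add] at hlim2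
  simp only [integral_const, probReal_univ, one_smul] at hlim
  refine hG'.trans (le_of_tendsto_of_tendsto hlim hlim2 ?_)
  filter_upwards [eventually_gt_atTop 0] with N hN
  have hN' : (0 : ℝ) < N := by exact_mod_cast hN
  rw [integral_div, integral_finsetSum _ fun k _ => hint k, div_le_iff₀ hN', add_mul,
    div_mul_cancel₀ _ hN'.ne', mul_comm _ (N : ℝ)]
  exact hav N

end Visits

/-! ### Projections in a given direction -/

/-- The projection of the plane along the vector `v`, not normalized: the determinant
of the pair `(v, x)`. -/
def detProj (v : Fin 2 → ℝ) (x : EuclideanSpace ℝ (Fin 2)) : ℝ := v 0 * x 1 - v 1 * x 0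

theorem volume_projAlong_mk {v : Fin 2 → ℝ} (hv : v ≠ 0)
    (K : Set (EuclideanSpace ℝ (Fin 2))) :
    volume (projAlong (Projectivization.mk ℝ v hv) '' K) =
      volume ((fun x => detProj v x / √(v 0 ^ 2 + v 1 ^ 2)) '' K) := by
  obtain ⟨a, ha⟩ := Projectivization.exists_smul_eq_mk_rep ℝ v hv
  have ha0 : (a : ℝ) ≠ 0 := a.ne_zero
  have h : projAlong (Projectivization.mk ℝ v hv) =
      fun x => ((a : ℝ) / |(a : ℝ)|) • (detProj v x / √(v 0 ^ 2 + v 1 ^ 2)) := by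
    funext x
    rw [projAlong, ← ha]
    simp only [Pi.smul_apply, Units.smul_def, smul_eq_mul, detProj]
    rw [show ((a : ℝ) * v 0) ^ 2 + (a * v 1) ^ 2 = (a : ℝ) ^ 2 * (v 0 ^ 2 + v 1 ^ 2) by ring,
      Real.sqrt_mul (sq_nonneg _), Real.sqrt_sq_eq_abs]
    have := (Real.sqrt_pos.2 (sq_add_sq_pos hv)).ne'
    have := abs_ne_zero.2 ha0
    field_simp
  rw [h, ← Set.image_image (g := fun y : ℝ => ((a : ℝ) / |(a : ℝ)|) • y), Set.image_smul,
    Measure.addHaar_smul]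
  simp [abs_div]

/-- The measure of the image of a compact set is upper semicontinuous in the map. -/
theorem isClosed_setOf_le_volume_image {X Y : Type*} [TopologicalSpace X] [TopologicalSpace Y]
    {Ψ : X → Y → ℝ} (hΨ : Continuous fun p : X × Y => Ψ p.1 p.2) {K : Set Y}
    (hK : IsCompact K) (c : ENNReal) : IsClosed {x | c ≤ volume (Ψ x '' K)} := by
  rw [← isOpen_compl_iff, isOpen_iff_mem_nhds]
  intro x hx
  rw [Set.mem_compl_iff, Set.mem_ofPred_eq, not_le] at hx
  obtain ⟨U, hU, hUo, hUc⟩ := Set.exists_isOpen_lt_of_lt _ _ hx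
  have hev : ∀ᶠ x' in 𝓝 x, ∀ y ∈ K, Ψ x' y ∈ U := by
    refine hK.eventually_forall_of_forall_eventually fun y hy => ?_
    exact (hΨ.tendsto (x, y)).eventually (hUo.mem_nhds (hU ⟨y, hy, rfl⟩))
  filter_upwards [hev] with x' hx'
  rw [Set.mem_compl_iff, Set.mem_ofPred_eq, not_le]
  refine (measure_mono ?_).trans_lt hUc
  rintro _ ⟨y, hy, rfl⟩
  exact hx' y hy

theorem isClosed_setOf_le_volume_projAlong {K : Set (EuclideanSpace ℝ (Fin 2))}
    (hK : IsCompact K) (c : ENNReal) : IsClosed {θ : RP1 | c ≤ volume (projAlong θ '' K)} := by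
  rw [← isQuotientMap_lineOf.isClosed_preimage]
  have : lineOf ⁻¹' {θ : RP1 | c ≤ volume (projAlong θ '' K)} =
      {v | c ≤ volume ((fun x => detProj v.1 x / √(v.1 0 ^ 2 + v.1 1 ^ 2)) '' K)} := by
    ext v
    rw [Set.mem_preimage, Set.mem_ofPred_eq, lineOf, volume_projAlong_mk]
    rfl
  rw [this]
  refine isClosed_setOf_le_volume_image (Ψ := fun (v : {v : Fin 2 → ℝ // v ≠ 0}) x =>
    detProj v.1 x / √(v.1 0 ^ 2 + v.1 1 ^ 2)) ?_ hK c
  unfold detProj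
  have h : ∀ i, Continuous fun p : {v : Fin 2 → ℝ // v ≠ 0} × EuclideanSpace ℝ (Fin 2) =>
      p.1.1 i := fun i => (continuous_coord i).comp continuous_fst
  have h' : ∀ i, Continuous fun p : {v : Fin 2 → ℝ // v ≠ 0} × EuclideanSpace ℝ (Fin 2) =>
      p.2 i := fun i => by fun_prop
  refine Continuous.div (((h 0).mul (h' 1)).sub ((h 1).mul (h' 0)))
    (((h 0).pow 2).add ((h 1).pow 2)).sqrt fun p =>
    (Real.sqrt_pos.2 (sq_add_sq_pos p.1.2)).ne'

/-- If the projections have positive measure for a set of directions of positive measure, then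
they have measure bounded below on a closed set of directions of positive measure. -/
theorem exists_closed_volume_projAlong_ge {K : Set (EuclideanSpace ℝ (Fin 2))}
    (μF : Measure RP1)
    (h : 0 < μF {θ : RP1 | 0 < volume (projAlong θ '' K)}) :
    ∃ c : ℝ, 0 < c ∧ 0 < μF {θ : RP1 | ENNReal.ofReal c ≤ volume (projAlong θ '' K)} := by
  by_contra! hcon
  refine h.ne' (measure_mono_null (t := ⋃ n : ℕ,
    {θ : RP1 | ENNReal.ofReal (1 / ((n : ℝ) + 1)) ≤ volume (projAlong θ '' K)}) ?_ ?_)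
  · intro θ hθ
    rw [Set.mem_ofPred_eq] at hθ
    rw [Set.mem_iUnion]
    obtain ⟨r, hr, hrlt⟩ := ENNReal.lt_iff_exists_real_btwn.1 hθ
    have hr0 : 0 < r := by
      by_contra h0
      simp [ENNReal.ofReal_of_nonpos (not_lt.1 h0)] at hrlt
    obtain ⟨n, hn⟩ := exists_nat_one_div_lt hr0
    exact ⟨n, (ENNReal.ofReal_le_ofReal hn.le).trans hrlt.2.le⟩
  · exact measure_iUnion_null fun n => nonpos_iff_eq_zero.1 (hcon _ (by positivity))

/-! ### Covers and projections -/

theorem exists_finset_cover {E : Set ℝ²} (hE : IsCompact E) {ε : ℝ≥0} (hε : 0 < ε) :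
    ∃ C : Finset ℝ², (∀ x ∈ E, ∃ c ∈ C, dist x c ≤ ε) ∧
      C.card = (Metric.externalCoveringNumber ε E).toNat := by
  obtain ⟨N, -, hNfin, hN⟩ := Metric.exists_finite_isCover_of_isCompact hε.ne' hE
  have hne : Nonempty {C : Set ℝ² // Metric.IsCover ε E C} := ⟨N, hN⟩
  obtain ⟨⟨C, hC⟩, hCeq⟩ :=
    ENat.exists_eq_iInf fun C : {C : Set ℝ² // Metric.IsCover ε E C} => C.1.encard
  have hCeq' : C.encard = Metric.externalCoveringNumber ε E := by
    rw [Metric.externalCoveringNumber, hCeq, iInf_subtype]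
  have hfin : C.Finite := by
    rw [← Set.encard_lt_top_iff, hCeq']
    exact hN.externalCoveringNumber_le_encard.trans_lt (Set.encard_lt_top_iff.2 hNfin)
  refine ⟨hfin.toFinset, fun x hx => ?_, ?_⟩
  · obtain ⟨c, hc, hxc⟩ := hC hx
    refine ⟨c, hfin.mem_toFinset.2 hc, ?_⟩
    have h : edist x c ≤ ε := hxc
    rw [edist_nndist] at h
    exact_mod_cast h
  · rw [← hCeq', ← Set.ncard_eq_toFinset_card C hfin]
    rfl

theorem coveringNumber_toNat_le {E : Set ℝ²} {ε : ℝ≥0} (C : Finset ℝ²)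
    (hC : ∀ x ∈ E, ∃ c ∈ C, dist x c ≤ ε) :
    (Metric.externalCoveringNumber ε E).toNat ≤ C.card := by
  have h : Metric.IsCover ε E (C : Set ℝ²) := by
    intro x hx
    obtain ⟨c, hc, hxc⟩ := hC x hx
    refine ⟨c, hc, ?_⟩
    change edist x c ≤ ε
    rw [edist_nndist]
    exact_mod_cast hxc
  have h2 := h.externalCoveringNumber_le_encard
  rw [Set.encard_coe_eq_coe_finsetCard] at h2
  exact ENat.toNat_le_of_le_natCast h2

theorem volume_image_le_of_cover {P : ℝ² → ℝ} (hP : LipschitzWith 1 P) {F : Set ℝ²} {ι : Type*}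
    (D : Finset ι) (c : ι → ℝ²) (r : ι → ℝ) (hr : ∀ i ∈ D, 0 ≤ r i)
    (hF : ∀ x ∈ F, ∃ i ∈ D, dist x (c i) ≤ r i) :
    volume (P '' F) ≤ ENNReal.ofReal (∑ i ∈ D, 2 * r i) := by
  have hsub : P '' F ⊆ ⋃ i ∈ D, Metric.closedBall (P (c i)) (r i) := by
    rintro _ ⟨x, hx, rfl⟩
    obtain ⟨i, hi, hxi⟩ := hF x hx
    refine Set.mem_biUnion hi ?_
    rw [Metric.mem_closedBall]
    have := hP.dist_le_mul x (c i)
    rw [NNReal.coe_one, one_mul] at this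
    exact this.trans hxi
  calc volume (P '' F) ≤ ∑ i ∈ D, volume (Metric.closedBall (P (c i)) (r i)) :=
        (measure_mono hsub).trans (measure_biUnion_finset_le _ _)
    _ = ∑ i ∈ D, ENNReal.ofReal (2 * r i) := by simp [Real.volume_closedBall]
    _ = _ := (ENNReal.ofReal_sum_of_nonneg fun i hi => mul_nonneg two_pos.le (hr i hi)).symm

/-- Pieces of a set that are separated by more than the diameter of the balls of a cover,
each with a long projection onto some line, force the cover to be large. -/
theorem sum_le_mul_card_of_separated {ι : Type*} (S : Finset ι) (F : ι → Set ℝ²)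
    (P : ι → ℝ² → ℝ) (hP : ∀ w ∈ S, LipschitzWith 1 (P w)) (l : ι → ℝ)
    (hl : ∀ w ∈ S, ENNReal.ofReal (l w) ≤ volume (P w '' F w)) (C : Finset ℝ²) {r : ℝ}
    (hr : 0 ≤ r) (hC : ∀ w ∈ S, ∀ x ∈ F w, ∃ c ∈ C, dist x c ≤ r)
    (hsep : ∀ w ∈ S, ∀ w' ∈ S, w ≠ w' → ∀ x ∈ F w, ∀ y ∈ F w', 2 * r < dist x y) :
    ∑ w ∈ S, l w ≤ 2 * r * C.card := by
  classical
  set D : ι → Finset ℝ² := fun w => C.filter fun c => ∃ x ∈ F w, dist x c ≤ r with hD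
  have h1 : ∀ w ∈ S, l w ≤ 2 * r * (D w).card := by
    intro w hw
    have h := (hl w hw).trans (volume_image_le_of_cover (hP w hw) (D w) id (fun _ => r)
      (fun _ _ => hr) fun x hx => by
        obtain ⟨c, hc, hxc⟩ := hC w hw x hx
        exact ⟨c, Finset.mem_filter.2 ⟨hc, x, hx, hxc⟩, hxc⟩)
    rw [Finset.sum_const, nsmul_eq_mul, ENNReal.ofReal_le_ofReal_iff (by positivity)] at h
    linarith
  have hdisj : (S : Set ι).PairwiseDisjoint D := by
    intro w hw w' hw' hne
    rw [Function.onFun, Finset.disjoint_left]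
    intro c hc hc'
    obtain ⟨-, x, hx, hxc⟩ := Finset.mem_filter.1 hc
    obtain ⟨-, y, hy, hyc⟩ := Finset.mem_filter.1 hc'
    have := hsep w hw w' hw' hne x hx y hy
    have := dist_triangle_right x y c
    linarith
  have h2 : (∑ w ∈ S, (D w).card) ≤ C.card := by
    rw [← Finset.card_biUnion hdisj]
    exact Finset.card_le_card (Finset.biUnion_subset.2 fun w _ => Finset.filter_subset _ _)
  calc ∑ w ∈ S, l w ≤ ∑ w ∈ S, 2 * r * (D w).card := Finset.sum_le_sum h1
    _ = 2 * r * ((∑ w ∈ S, (D w).card : ℕ) : ℝ) := by rw [← Finset.mul_sum]; push_cast; rfl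
    _ ≤ _ := by gcongr

/-- The image of a ball under a planar matrix is covered by about `α₁ / α₂` balls of radius
about `α₂`, centred along the long axis. -/
theorem exists_ellipse_cover (B : GL (Fin 2) ℝ) {R : ℝ} (hR : 0 ≤ R) :
    ∃ C : Finset ℝ², (C.card : ℝ) ≤ (2 * R + 5) *
        (sv₁ (B : Matrix (Fin 2) (Fin 2) ℝ) / sv₂ (B : Matrix (Fin 2) (Fin 2) ℝ)) ∧
      ∀ z : ℝ², ‖z‖ ≤ R → ∃ c ∈ C, ‖act (B : Matrix (Fin 2) (Fin 2) ℝ) z - c‖ ≤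
        (1 + R) * sv₂ (B : Matrix (Fin 2) (Fin 2) ℝ) := by
  classical
  obtain ⟨b, h₀, h₁, -⟩ := exists_singularBasis (B : Matrix (Fin 2) (Fin 2) ℝ)
  set s₁ := sv₁ (B : Matrix (Fin 2) (Fin 2) ℝ)
  set s₂ := sv₂ (B : Matrix (Fin 2) (Fin 2) ℝ)
  have hs₁ : 0 < s₁ := sv₁_pos B
  have hs₂ : 0 < s₂ := sv₂_pos B
  have hs : 1 ≤ s₁ / s₂ := (one_le_div hs₂).2 (sv₂_le_sv₁ _)
  set M : ℕ := ⌈R * (s₁ / s₂)⌉₊ + 1 with hM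
  have hMlt : (M : ℝ) < R * (s₁ / s₂) + 2 := by
    have := Nat.ceil_lt_add_one (a := R * (s₁ / s₂)) (by positivity)
    push_cast [hM]
    linarith
  refine ⟨(Finset.Icc (-(M : ℤ)) M).image fun j : ℤ =>
    ((j : ℝ) * (s₂ / s₁)) • act (B : Matrix (Fin 2) (Fin 2) ℝ) (b 0), ?_, fun z hz => ?_⟩
  · have h2 : (((Finset.Icc (-(M : ℤ)) M).card : ℕ) : ℝ) = 2 * M + 1 := by
      rw [Int.card_Icc]
      have : ((M : ℤ) + 1 - -(M : ℤ)).toNat = 2 * M + 1 := by omega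
      rw [this]
      push_cast
      ring
    have h3 : (((Finset.Icc (-(M : ℤ)) M).image fun j : ℤ =>
        ((j : ℝ) * (s₂ / s₁)) • act (B : Matrix (Fin 2) (Fin 2) ℝ) (b 0)).card : ℝ) ≤
        2 * M + 1 := by
      rw [← h2]
      exact_mod_cast Finset.card_image_le
    nlinarith
  · have hcoord : ∀ i, |b.repr z i| ≤ R := fun i => by
      have h := PiLp.norm_apply_le (b.repr z) i
      rw [b.repr.norm_map, Real.norm_eq_abs] at h
      exact h.trans hz
    set t := b.repr z 0 * (s₁ / s₂) with ht
    have htabs : |t| ≤ R * (s₁ / s₂) := by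
      rw [ht, abs_mul, abs_of_pos (div_pos hs₁ hs₂)]
      exact mul_le_mul_of_nonneg_right (hcoord 0) (by positivity)
    have hMge : R * (s₁ / s₂) ≤ M - 1 := by
      have := Nat.le_ceil (R * (s₁ / s₂))
      push_cast [hM]
      linarith
    refine ⟨_, Finset.mem_image_of_mem _ (a := ⌊t⌋) (Finset.mem_Icc.2 ⟨?_, ?_⟩), ?_⟩
    · rw [Int.le_floor]
      push_cast
      linarith [neg_le_of_abs_le htabs]
    · have h1 : (⌊t⌋ : ℝ) ≤ M := (Int.floor_le t).trans (by linarith [le_of_abs_le htabs])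
      exact_mod_cast h1
    · have hz' : act (B : Matrix (Fin 2) (Fin 2) ℝ) z -
          ((⌊t⌋ : ℝ) * (s₂ / s₁)) • act (B : Matrix (Fin 2) (Fin 2) ℝ) (b 0) =
          ((t - ⌊t⌋) * (s₂ / s₁)) • act (B : Matrix (Fin 2) (Fin 2) ℝ) (b 0) +
          b.repr z 1 • act (B : Matrix (Fin 2) (Fin 2) ℝ) (b 1) := by
        conv_lhs => rw [← b.sum_repr z]
        rw [Fin.sum_univ_two, map_add, map_smul, map_smul, sub_mul, sub_smul]
        have : t * (s₂ / s₁) = b.repr z 0 := by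
          rw [ht]; field_simp
        rw [this]
        abel
      rw [hz']
      refine (norm_add_le _ _).trans ?_
      rw [norm_smul, norm_smul, h₀, h₁, Real.norm_eq_abs, Real.norm_eq_abs, abs_mul,
        abs_of_nonneg (sub_nonneg.2 (Int.floor_le t)), abs_of_pos (div_pos hs₂ hs₁),
        mul_assoc, div_mul_cancel₀ _ hs₁.ne']
      have h5 : t - ⌊t⌋ ≤ 1 := by linarith [Int.lt_floor_add_one t]
      nlinarith [hcoord 1, mul_le_mul_of_nonneg_right h5 hs₂.le,
        mul_le_mul_of_nonneg_right (hcoord 1) hs₂.le]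

/-! ### The iterated function system -/

section IFS

variable {m : ℕ} (A : Fin m → GL (Fin 2) ℝ) (d : Fin m → ℝ²)

/-- The composition of the affine maps of the system along a finite word. -/
def wordMap : {n : ℕ} → (Fin n → Fin m) → ℝ² → ℝ²
  | 0, _, x => x
  | _ + 1, w, x => affineMapOf (A (w 0)) (d (w 0)) (wordMap (fun k => w k.succ) x)

theorem affineMapOf_sub (g : GL (Fin 2) ℝ) (e x y : ℝ²) :
    affineMapOf g e x - affineMapOf g e y = act (g : Matrix (Fin 2) (Fin 2) ℝ) (x - y) := by
  simp [affineMapOf]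

theorem wordMap_sub {n : ℕ} (w : Fin n → Fin m) (x y : ℝ²) :
    wordMap A d w x - wordMap A d w y = act (wordProd A w) (x - y) := by
  induction n with
  | zero => simp [wordMap, wordProd_zero]
  | succ n ih =>
    rw [wordMap, wordMap, affineMapOf_sub, ih, wordProd_succ, act_mul_apply]

theorem affineMapOf_mem {E : Set ℝ²} (hE : E = ⋃ i, affineMapOf (A i) (d i) '' E)
    (i : Fin m) {x : ℝ²} (hx : x ∈ E) : affineMapOf (A i) (d i) x ∈ E := by
  rw [hE]
  exact Set.mem_iUnion.2 ⟨i, x, hx, rfl⟩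

theorem wordMap_mem {E : Set ℝ²} (hE : E = ⋃ i, affineMapOf (A i) (d i) '' E)
    {n : ℕ} (w : Fin n → Fin m) {x : ℝ²} (hx : x ∈ E) :
    wordMap A d w x ∈ E := by
  induction n with
  | zero => exact hx
  | succ n ih => exact affineMapOf_mem A d hE _ (ih _)

/-- Every point of the attractor has a coding sequence. -/
theorem exists_coding {E : Set ℝ²} (hE : E = ⋃ i, affineMapOf (A i) (d i) '' E)
    {x : ℝ²} (hx : x ∈ E) :
    ∃ a : ℕ → Fin m, ∀ n, ∃ y ∈ E, wordMap A d (initialWord a n) y = x := by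
  have hstep : ∀ z : E, ∃ i, ∃ y : E, affineMapOf (A i) (d i) y = z := by
    intro z
    obtain ⟨i, y, hy, hyz⟩ := Set.mem_iUnion.1 (hE.subset z.2)
    exact ⟨i, ⟨y, hy⟩, hyz⟩
  choose i y hy using hstep
  have key : ∀ (n : ℕ) (z : E),
      wordMap A d (initialWord (fun k => i (y^[k] z)) n) (y^[n] z : E) = z := by
    intro n
    induction n with
    | zero => intro z; rfl
    | succ n ih =>
      intro z
      exact (congrArg (affineMapOf (A (i z)) (d (i z))) (ih (y z))).trans (hy z)
  exact ⟨fun k => i (y^[k] ⟨x, hx⟩), fun n => ⟨_, (y^[n] ⟨x, hx⟩).2, key n ⟨x, hx⟩⟩⟩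

/-- Strong separation on the first level separates the pieces of level `n` by the smaller
singular value. The extra matrix `B` carries the common prefix through the induction. -/
theorem wordMap_separation {E : Set ℝ²} (hE : E = ⋃ i, affineMapOf (A i) (d i) '' E)
    (hA : ∀ i, sv₁ (A i : Matrix (Fin 2) (Fin 2) ℝ) ≤ 1) {δ : ℝ}
    (hδ₀ : 0 ≤ δ) (hδ : ∀ i j, i ≠ j → ∀ x ∈ E, ∀ y ∈ E,
      δ ≤ dist (affineMapOf (A i) (d i) x) (affineMapOf (A j) (d j) y))
    {n : ℕ} (B : Matrix (Fin 2) (Fin 2) ℝ) {w w' : Fin n → Fin m} (hw : w ≠ w')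
    {x y : ℝ²} (hx : x ∈ E) (hy : y ∈ E) :
    δ * sv₂ (B * wordProd A w) ≤ ‖act B (wordMap A d w x - wordMap A d w' y)‖ := by
  induction n generalizing B with
  | zero => exact absurd (Subsingleton.elim w w') hw
  | succ n ih =>
    by_cases h0 : w 0 = w' 0
    · have htail : (fun k => w (Fin.succ k)) ≠ fun k => w' (Fin.succ k) := by
        intro h
        refine hw (funext fun k => ?_)
        rcases Fin.eq_zero_or_eq_succ k with rfl | ⟨k, rfl⟩
        · exact h0
        · exact congrFun h k
      have := ih (B * A (w 0)) htail
      rw [wordProd_succ, wordMap, wordMap, ← h0, affineMapOf_sub, ← mul_assoc,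
        ← act_mul_apply]
      exact this
    · have h1 := hδ _ _ h0 _ (wordMap_mem A d hE (fun k => w (Fin.succ k)) hx) _
        (wordMap_mem A d hE (fun k => w' (Fin.succ k)) hy)
      rw [dist_eq_norm] at h1
      have h2 : sv₂ (B * wordProd A w) ≤ sv₂ B := by
        have h3 := sv₂_mul_le B (wordGL A w)
        rw [coe_wordGL] at h3
        have h4 := sv₁_wordProd_le A hA w
        rw [one_pow] at h4
        exact h3.trans (mul_le_of_le_one_right (sv₂_nonneg B) h4)
      calc δ * sv₂ (B * wordProd A w) ≤ sv₂ B * δ := by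
            rw [mul_comm]; exact mul_le_mul_of_nonneg_right h2 hδ₀
        _ ≤ sv₂ B * ‖wordMap A d w x - wordMap A d w' y‖ :=
            mul_le_mul_of_nonneg_left h1 (sv₂_nonneg B)
        _ ≤ _ := sv₂_mul_norm_le B _

/-- Strong separation gives a positive distance between the first level pieces. -/
theorem exists_separation_constant {E : Set ℝ²} (hE_compact : IsCompact E)
    (hsep : Pairwise fun i j =>
      Disjoint (affineMapOf (A i) (d i) '' E) (affineMapOf (A j) (d j) '' E)) :
    ∃ δ : ℝ, 0 < δ ∧ ∀ i j, i ≠ j → ∀ x ∈ E, ∀ y ∈ E,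
      δ ≤ dist (affineMapOf (A i) (d i) x) (affineMapOf (A j) (d j) y) := by
  have hcomp : ∀ i, IsCompact (affineMapOf (A i) (d i) '' E) := fun i =>
    hE_compact.image (by unfold affineMapOf; fun_prop)
  have hev : ∀ᶠ δ : ℝ in 𝓝[>] 0, ∀ i j, i ≠ j → ∀ x ∈ E, ∀ y ∈ E,
      δ ≤ dist (affineMapOf (A i) (d i) x) (affineMapOf (A j) (d j) y) := by
    rw [eventually_all]
    intro i
    rw [eventually_all]
    intro j
    by_cases hij : i = j
    · exact Eventually.of_forall fun δ h => absurd hij h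
    obtain ⟨r, hr, hrd⟩ :=
      Metric.exists_pos_forall_lt_edist (hcomp i) (hcomp j).isClosed (hsep hij)
    filter_upwards [Ioc_mem_nhdsGT (show (0 : ℝ) < r from hr)] with δ hδ _ x hx y hy
    have h := hrd _ ⟨x, hx, rfl⟩ _ ⟨y, hy, rfl⟩
    rw [edist_nndist] at h
    exact hδ.2.trans (by exact_mod_cast h.le)
  obtain ⟨δ, h1, h2⟩ := (hev.and self_mem_nhdsWithin).exists
  exact ⟨δ, h2, h1⟩

end IFS

/-! ### Long projections of the pieces -/

theorem lipschitzWith_detProj_div (v : Fin 2 → ℝ) (hv : v ≠ 0) :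
    LipschitzWith 1 fun x : ℝ² => detProj v x / √(v 0 ^ 2 + v 1 ^ 2) := by
  refine LipschitzWith.of_dist_le_mul fun x y => ?_
  have hpos := sq_add_sq_pos hv
  rw [NNReal.coe_one, one_mul, Real.dist_eq, ← sub_div, abs_div,
    abs_of_pos (Real.sqrt_pos.2 hpos), div_le_iff₀ (Real.sqrt_pos.2 hpos), EuclideanSpace.dist_eq,
    ← Real.sqrt_mul (by positivity)]
  refine Real.le_sqrt_of_sq_le ?_
  simp only [sq_abs, Fin.sum_univ_two, Real.dist_eq, detProj]
  nlinarith [sq_nonneg (v 0 * (x 0 - y 0) + v 1 * (x 1 - y 1))]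

theorem volume_image_mul_add (a b : ℝ) (S : Set ℝ) :
    volume ((fun y => a * y + b) '' S) = ENNReal.ofReal |a| * volume S := by
  rw [show (fun y : ℝ => a * y + b) = (fun y => y + b) ∘ fun y => a • y from rfl,
    Set.image_comp, Set.image_smul, Set.image_add_right, measure_preimage_add_right,
    Measure.addHaar_smul]
  simp

theorem detProj_mulVec (M : Matrix (Fin 2) (Fin 2) ℝ) (u : Fin 2 → ℝ) (x : ℝ²) :
    detProj (M *ᵥ u) (act M x) = M.det * detProj u x := by
  have h : ∀ i, act M x i = (M *ᵥ x.ofLp) i := fun i => rfl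
  simp only [detProj, h, Matrix.mulVec, dotProduct, Fin.sum_univ_two, Matrix.det_fin_two]
  ring

theorem sv₁_le_sum {M : Matrix (Fin 2) (Fin 2) ℝ} (hM : ∀ k l, 0 ≤ M k l) :
    sv₁ M ≤ M 0 0 + M 0 1 + M 1 0 + M 1 1 := by
  have h00 := hM 0 0
  have h01 := hM 0 1
  have h10 := hM 1 0
  have h11 := hM 1 1
  rw [sv₁_eq_norm]
  refine (act M).opNorm_le_bound (by positivity) fun x => ?_
  have hx : ∀ i, |x i| ≤ ‖x‖ := fun i => PiLp.norm_apply_le x i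
  have hy : ∀ i, |act M x i| ≤ (M i 0 + M i 1) * ‖x‖ := by
    intro i
    have h : act M x i = M i 0 * x 0 + M i 1 * x 1 := by
      change (M *ᵥ x.ofLp) i = _
      simp [Matrix.mulVec, dotProduct, Fin.sum_univ_two]
    rw [h]
    refine (abs_add_le _ _).trans ?_
    rw [abs_mul, abs_mul, abs_of_nonneg (hM i 0), abs_of_nonneg (hM i 1), add_mul]
    exact add_le_add (mul_le_mul_of_nonneg_left (hx 0) (hM i 0))
      (mul_le_mul_of_nonneg_left (hx 1) (hM i 1))
  refine le_of_sq_le_sq ?_ (by positivity)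
  rw [EuclideanSpace.norm_sq_eq]
  simp only [Fin.sum_univ_two, Real.norm_eq_abs]
  have e0 := pow_le_pow_left₀ (abs_nonneg _) (hy 0) 2
  have e1 := pow_le_pow_left₀ (abs_nonneg _) (hy 1) 2
  have : 0 ≤ (M 0 0 + M 0 1) * ‖x‖ * ((M 1 0 + M 1 1) * ‖x‖) := by positivity
  nlinarith

theorem wordProd_nonneg {m : ℕ} (A : Fin m → GL (Fin 2) ℝ)
    (hA : ∀ i k l, 0 < (A i : Matrix (Fin 2) (Fin 2) ℝ) k l) {n : ℕ} (w : Fin n → Fin m)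
    (k l : Fin 2) : 0 ≤ wordProd A w k l := by
  induction n generalizing k l with
  | zero =>
    rw [wordProd_zero, Matrix.one_apply]
    split_ifs <;> norm_num
  | succ n ih =>
    rw [wordProd_succ, Matrix.mul_apply]
    exact Finset.sum_nonneg fun j _ => mul_nonneg (hA _ _ _).le (ih _ _ _)

/-- Every row sum of a nonempty product of matrices from a finite positive family is comparable to
the norm of the product: with `lo` and `hi` bounding all entries, already the leftmost factor makes
the two row sums comparable to each other. -/
theorem exists_row_ratio {m : ℕ} (A : Fin m → GL (Fin 2) ℝ)
    (hA : ∀ i k l, 0 < (A i : Matrix (Fin 2) (Fin 2) ℝ) k l) :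
    ∃ τ : ℝ, 0 < τ ∧ ∀ (n : ℕ) (w : Fin (n + 1) → Fin m) (i : Fin 2),
      τ * sv₁ (wordProd A w) ≤ wordProd A w i 0 + wordProd A w i 1 := by
  have hev : ∀ᶠ lo : ℝ in 𝓝[>] 0, ∀ i k l, lo ≤ (A i : Matrix (Fin 2) (Fin 2) ℝ) k l := by
    simp only [eventually_all]
    intro i k l
    filter_upwards [Ioc_mem_nhdsGT (hA i k l)] with x hx
    exact hx.2
  have hev' : ∀ᶠ hi : ℝ in atTop, ∀ i k l, (A i : Matrix (Fin 2) (Fin 2) ℝ) k l ≤ hi := by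
    simp only [eventually_all]
    intro i k l
    exact eventually_ge_atTop _
  obtain ⟨lo, hlo, hlo₀ : 0 < lo⟩ := (hev.and self_mem_nhdsWithin).exists
  obtain ⟨hi, hhi, hhi₀⟩ := (hev'.and (eventually_gt_atTop 0)).exists
  refine ⟨lo / (2 * hi), by positivity, fun n w i => ?_⟩
  set B := wordProd A fun k => w (Fin.succ k) with hB
  have hrow : ∀ i, wordProd A w i 0 + wordProd A w i 1 =
      (A (w 0) : Matrix (Fin 2) (Fin 2) ℝ) i 0 * (B 0 0 + B 0 1) +
      (A (w 0) : Matrix (Fin 2) (Fin 2) ℝ) i 1 * (B 1 0 + B 1 1) := by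
    intro i
    rw [wordProd_succ, Matrix.mul_apply, Matrix.mul_apply, Fin.sum_univ_two, Fin.sum_univ_two]
    ring
  have hB0 : 0 ≤ B 0 0 + B 0 1 :=
    add_nonneg (wordProd_nonneg A hA _ _ _) (wordProd_nonneg A hA _ _ _)
  have hB1 : 0 ≤ B 1 0 + B 1 1 :=
    add_nonneg (wordProd_nonneg A hA _ _ _) (wordProd_nonneg A hA _ _ _)
  have hlow : lo * (B 0 0 + B 0 1 + (B 1 0 + B 1 1)) ≤ wordProd A w i 0 + wordProd A w i 1 := by
    rw [hrow i, mul_add]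
    exact add_le_add (mul_le_mul_of_nonneg_right (hlo _ _ _) hB0)
      (mul_le_mul_of_nonneg_right (hlo _ _ _) hB1)
  have hup : ∀ i, wordProd A w i 0 + wordProd A w i 1 ≤
      hi * (B 0 0 + B 0 1 + (B 1 0 + B 1 1)) := by
    intro i
    rw [hrow i, mul_add hi]
    exact add_le_add (mul_le_mul_of_nonneg_right (hhi _ _ _) hB0)
      (mul_le_mul_of_nonneg_right (hhi _ _ _) hB1)
  have hsv := sv₁_le_sum (wordProd_nonneg A hA w)
  have h2 : sv₁ (wordProd A w) ≤ 2 * hi * (B 0 0 + B 0 1 + (B 1 0 + B 1 1)) := by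
    linarith [hup 0, hup 1]
  calc lo / (2 * hi) * sv₁ (wordProd A w) ≤
        lo / (2 * hi) * (2 * hi * (B 0 0 + B 0 1 + (B 1 0 + B 1 1))) := by gcongr
    _ = lo * (B 0 0 + B 0 1 + (B 1 0 + B 1 1)) := by field_simp
    _ ≤ _ := hlow

/-- If `M u` lies in the negative quadrant, where `M` has nonnegative entries, then no cancellation
occurs in `det M • u = adj(M) (M u)`, so this vector is bounded below through the row sums. -/
theorem row_mul_norm_le {M : Matrix (Fin 2) (Fin 2) ℝ} {ρ : ℝ} (hρ : 0 ≤ ρ)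
    (hM : ∀ k l, 0 ≤ M k l)
    (hrow : ∀ i, ρ ≤ M i 0 + M i 1) {u v : Fin 2 → ℝ} (huv : M *ᵥ u = v) (hv : v 0 * v 1 ≤ 0) :
    ρ / 2 * √(v 0 ^ 2 + v 1 ^ 2) ≤ |M.det| * √(u 0 ^ 2 + u 1 ^ 2) := by
  have e0 : M.det * u 0 = M 1 1 * v 0 - M 0 1 * v 1 := by
    rw [← huv, Matrix.det_fin_two]
    simp only [Matrix.mulVec, dotProduct, Fin.sum_univ_two]
    ring
  have e1 : M.det * u 1 = M 0 0 * v 1 - M 1 0 * v 0 := by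
    rw [← huv, Matrix.det_fin_two]
    simp only [Matrix.mulVec, dotProduct, Fin.sum_univ_two]
    ring
  have h00 := hM 0 0
  have h01 := hM 0 1
  have h10 := hM 1 0
  have h11 := hM 1 1
  have r0 := hrow 0
  have r1 := hrow 1
  rw [← Real.sqrt_sq (by positivity : 0 ≤ ρ / 2), ← Real.sqrt_sq_eq_abs,
    ← Real.sqrt_mul (sq_nonneg _), ← Real.sqrt_mul (sq_nonneg _)]
  refine Real.sqrt_le_sqrt ?_
  have e2 : M.det ^ 2 * (u 0 ^ 2 + u 1 ^ 2) =
      (M 1 1 * v 0 - M 0 1 * v 1) ^ 2 + (M 0 0 * v 1 - M 1 0 * v 0) ^ 2 := by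
    rw [← e0, ← e1]; ring
  rw [e2]
  have c1 := mul_nonneg (mul_nonneg h11 h01) (neg_nonneg.2 hv)
  have c2 := mul_nonneg (mul_nonneg h00 h10) (neg_nonneg.2 hv)
  have s0 : ρ ^ 2 ≤ (M 0 0 + M 0 1) ^ 2 := pow_le_pow_left₀ hρ r0 2
  have s1 : ρ ^ 2 ≤ (M 1 0 + M 1 1) ^ 2 := pow_le_pow_left₀ hρ r1 2
  have t0 := mul_le_mul_of_nonneg_right s0 (sq_nonneg (v 1))
  have t1 := mul_le_mul_of_nonneg_right s1 (sq_nonneg (v 0))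
  have q0 := mul_nonneg (sq_nonneg (M 1 1 - M 1 0)) (sq_nonneg (v 0))
  have q1 := mul_nonneg (sq_nonneg (M 0 1 - M 0 0)) (sq_nonneg (v 1))
  have p0 := mul_nonneg (sq_nonneg ρ) (sq_nonneg (v 0))
  have p1 := mul_nonneg (sq_nonneg ρ) (sq_nonneg (v 1))
  nlinarith

/-- The piece of a visiting word `w` projects, in some direction of the negative quadrant, onto a
set of measure comparable to `α₁(A_w)`. -/
theorem exists_long_projection {m : ℕ} (A : Fin m → GL (Fin 2) ℝ) (d : Fin m → ℝ²)
    (hA : ∀ i k l, 0 < (A i : Matrix (Fin 2) (Fin 2) ℝ) k l) (E : Set ℝ²) {c : ℝ} (hc : 0 < c) :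
    ∃ τ : ℝ, 0 < τ ∧ ∀ (n : ℕ), ∀ w ∈ visitingWords A
        {θ : RP1 | ENNReal.ofReal c ≤ volume (projAlong θ '' E)} (n + 1),
      ∃ P : ℝ² → ℝ, LipschitzWith 1 P ∧
        ENNReal.ofReal (τ * sv₁ (wordProd A w)) ≤ volume (P '' (wordMap A d w '' E)) := by
  obtain ⟨τ, hτ, hrow⟩ := exists_row_ratio A hA
  refine ⟨τ / 2 * c, by positivity, fun n w hw => ?_⟩
  obtain ⟨θ, hθ, hθE⟩ := hw
  induction θ using Projectivization.ind with | h v hv => ?_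
  rw [mk_mem_negQuadrant] at hθ
  rw [Projectivization.smul_mk, Set.mem_ofPred_eq, volume_projAlong_mk] at hθE
  set u : Fin 2 → ℝ := (wordGL A w)⁻¹ • v with hu
  have huv : wordProd A w *ᵥ u = v := smul_inv_smul (wordGL A w) v
  have hu0 : u ≠ 0 := (smul_ne_zero_iff_ne (a := (wordGL A w)⁻¹)).mpr hv
  have hnorm := row_mul_norm_le (mul_nonneg hτ.le (sv₁_nonneg _)) (wordProd_nonneg A hA w)
    (hrow n w) huv hθ
  refine ⟨_, lipschitzWith_detProj_div v hv, ?_⟩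
  have hvpos := Real.sqrt_pos.2 (sq_add_sq_pos hv)
  have hupos := Real.sqrt_pos.2 (sq_add_sq_pos hu0)
  set a : ℝ := (wordProd A w).det * √(u 0 ^ 2 + u 1 ^ 2) / √(v 0 ^ 2 + v 1 ^ 2) with ha
  have himg : (fun x => detProj v x / √(v 0 ^ 2 + v 1 ^ 2)) '' (wordMap A d w '' E) =
      (fun y => a * y + detProj v (wordMap A d w 0) / √(v 0 ^ 2 + v 1 ^ 2)) ''
        ((fun x => detProj u x / √(u 0 ^ 2 + u 1 ^ 2)) '' E) := by
    rw [Set.image_image, Set.image_image]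
    refine Set.image_congr fun x _ => ?_
    have h1 : wordMap A d w x = act (wordProd A w) x + wordMap A d w 0 := by
      have := wordMap_sub A d w x 0
      rw [sub_zero] at this
      rw [← this, sub_add_cancel]
    have h2 : detProj v (act (wordProd A w) x) = (wordProd A w).det * detProj u x := by
      rw [← detProj_mulVec, huv]
    have h3 : detProj v (wordMap A d w x) =
        (wordProd A w).det * detProj u x + detProj v (wordMap A d w 0) := by
      rw [← h2, h1]
      simp only [detProj, PiLp.add_apply]
      ring
    rw [h3, ha]
    field_simp
  rw [himg, volume_image_mul_add]
  have habs : τ / 2 * sv₁ (wordProd A w) ≤ |a| := by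
    rw [ha, abs_div, abs_mul, abs_of_pos hvpos, abs_of_pos hupos, le_div_iff₀ hvpos]
    linarith
  calc ENNReal.ofReal (τ / 2 * c * sv₁ (wordProd A w)) =
        ENNReal.ofReal (τ / 2 * sv₁ (wordProd A w)) * ENNReal.ofReal c := by
        rw [← ENNReal.ofReal_mul (mul_nonneg (by positivity) (sv₁_nonneg _))]
        congr 1
        ring
    _ ≤ _ := mul_le_mul' (ENNReal.ofReal_le_ofReal habs) hθE

/-! ### The singular value sums -/

section SingularValueSums

variable {m : ℕ} (A : Fin m → GL (Fin 2) ℝ)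

theorem svFunction_of_one_lt {s : ℝ} (hs : 1 < s) (M : Matrix (Fin 2) (Fin 2) ℝ) :
    svFunction s M = sv₁ M * sv₂ M ^ (s - 1) := by
  rw [svFunction, if_neg hs.not_ge]

theorem svFunction_pos {n : ℕ} (s : ℝ) (w : Fin n → Fin m) :
    0 < svFunction s (wordProd A w) := by
  have h1 := sv₁_wordProd_pos A w
  have h2 := sv₂_wordProd_pos A w
  rw [svFunction]
  split_ifs <;> positivity

theorem exists_sv₁_lt_one (hA : ∀ i, sv₁ (A i : Matrix (Fin 2) (Fin 2) ℝ) < 1) :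
    ∃ ρ : ℝ, 0 < ρ ∧ ρ < 1 ∧ ∀ i, sv₁ (A i : Matrix (Fin 2) (Fin 2) ℝ) ≤ ρ := by
  have hev : ∀ᶠ ρ : ℝ in 𝓝[<] 1, ∀ i, sv₁ (A i : Matrix (Fin 2) (Fin 2) ℝ) ≤ ρ := by
    rw [eventually_all]
    intro i
    filter_upwards [Ico_mem_nhdsLT (hA i)] with x hx
    exact hx.1
  obtain ⟨ρ, h1, h2⟩ := (hev.and (Ioo_mem_nhdsLT (zero_lt_one (α := ℝ)))).exists
  exact ⟨ρ, h2.1, h2.2, h1⟩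

theorem exists_sv₂_pos : ∃ κ : ℝ, 0 < κ ∧ κ < 1 ∧
    ∀ i, κ ≤ sv₂ (A i : Matrix (Fin 2) (Fin 2) ℝ) := by
  have hev : ∀ᶠ κ : ℝ in 𝓝[>] 0, ∀ i, κ ≤ sv₂ (A i : Matrix (Fin 2) (Fin 2) ℝ) := by
    rw [eventually_all]
    intro i
    filter_upwards [Ioc_mem_nhdsGT (sv₂_pos (A i))] with x hx
    exact hx.2
  obtain ⟨κ, h1, h2⟩ := (hev.and (Ioo_mem_nhdsGT (zero_lt_one (α := ℝ)))).exists
  exact ⟨κ, h2.1, h2.2, h1⟩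

/-- The set of exponents defining the affinity dimension is nonempty, so that its infimum is not a
junk value. -/
theorem exists_summable_svFunction (hA : ∀ i, sv₁ (A i : Matrix (Fin 2) (Fin 2) ℝ) < 1) :
    ∃ s : ℝ, 0 < s ∧
      Summable fun n : ℕ => ∑ w : Fin (n + 1) → Fin m, svFunction s (wordProd A w) := by
  obtain ⟨ρ, hρ₀, hρ₁, hρ⟩ := exists_sv₁_lt_one A hA
  obtain ⟨k, hk⟩ : ∃ k : ℕ, (m : ℝ) * ρ ^ k < 1 := by
    have h : Tendsto (fun k : ℕ => (m : ℝ) * ρ ^ k) atTop (𝓝 (m * 0)) :=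
      (tendsto_pow_atTop_nhds_zero_of_lt_one hρ₀.le hρ₁).const_mul _
    rw [mul_zero] at h
    exact (h.eventually (gt_mem_nhds one_pos)).exists
  have hs : (1 : ℝ) < k + 2 := by
    have : (0 : ℝ) ≤ k := Nat.cast_nonneg k
    linarith
  have hm : (m : ℝ) * ρ ^ (k + 2) < 1 := by
    refine lt_of_le_of_lt ?_ hk
    exact mul_le_mul_of_nonneg_left (pow_le_pow_of_le_one hρ₀.le hρ₁.le (by omega))
      (Nat.cast_nonneg m)
  refine ⟨k + 2, by linarith, ?_⟩
  refine Summable.of_nonneg_of_le (fun n => Finset.sum_nonneg fun w _ => (svFunction_pos A _ w).le)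
    (fun n => ?_) ((summable_nat_add_iff 1).2
      (summable_geometric_of_lt_one (by positivity) hm))
  have hterm : ∀ w : Fin (n + 1) → Fin m,
      svFunction (k + 2 : ℝ) (wordProd A w) ≤ (ρ ^ (k + 2)) ^ (n + 1) := by
    intro w
    have h1 := sv₁_wordProd_le A hρ w
    have h2 := (sv₂_le_sv₁ _).trans h1
    rw [svFunction_of_one_lt hs, show (k : ℝ) + 2 - 1 = ((k + 1 : ℕ) : ℝ) by push_cast; ring,
      Real.rpow_natCast]
    calc sv₁ (wordProd A w) * sv₂ (wordProd A w) ^ (k + 1) ≤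
          ρ ^ (n + 1) * (ρ ^ (n + 1)) ^ (k + 1) := by
          gcongr
          exacts [pow_nonneg (sv₂_nonneg _) _, sv₂_nonneg _]
      _ = _ := by ring
  calc ∑ w : Fin (n + 1) → Fin m, svFunction (k + 2 : ℝ) (wordProd A w) ≤
        ∑ _w : Fin (n + 1) → Fin m, (ρ ^ (k + 2)) ^ (n + 1) :=
        Finset.sum_le_sum fun w _ => hterm w
    _ = _ := by
        rw [Finset.sum_const, Finset.card_univ, Fintype.card_fun, Fintype.card_fin,
          Fintype.card_fin, nsmul_eq_mul, mul_pow]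
        push_cast
        ring

/-- At the affinity dimension the singular value sums grow at most subexponentially. -/
theorem eventually_sum_svFunction_le (hA : ∀ i, sv₁ (A i : Matrix (Fin 2) (Fin 2) ℝ) < 1)
    (hdim : 1 < affinityDim A) {ε : ℝ} (hε : 0 < ε) :
    ∀ᶠ n : ℕ in atTop, ∑ w : Fin n → Fin m, svFunction (affinityDim A) (wordProd A w) ≤
      Real.exp (n * ε) := by
  obtain ⟨κ, hκ₀, hκ₁, hκ⟩ := exists_sv₂_pos A
  have hlogκ : Real.log κ < 0 := Real.log_neg hκ₀ hκ₁
  set s := affinityDim A with hs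
  obtain ⟨s', ⟨hs'₀, hs'⟩, hs'lt⟩ := exists_lt_of_csInf_lt
    (s := {s : ℝ | 0 < s ∧ Summable fun n : ℕ => ∑ w : Fin (n + 1) → Fin m,
      svFunction s (wordProd A w)}) (exists_summable_svFunction A hA)
    (show sInf _ < s + ε / -Real.log κ from
      lt_add_of_pos_right _ (div_pos hε (neg_pos.2 hlogκ)))
  have hss' : s ≤ s' := csInf_le ⟨0, fun x hx => hx.1.le⟩ ⟨hs'₀, hs'⟩
  have hev : ∀ᶠ n : ℕ in atTop, ∑ w : Fin n → Fin m, svFunction s' (wordProd A w) ≤ 1 := by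
    have h := (tendsto_add_atTop_iff_nat (f := fun n =>
      ∑ w : Fin n → Fin m, svFunction s' (wordProd A w)) 1).1 hs'.tendsto_atTop_zero
    filter_upwards [h.eventually (gt_mem_nhds one_pos)] with n hn
    exact hn.le
  filter_upwards [hev] with n hn
  have hterm : ∀ w : Fin n → Fin m, svFunction s (wordProd A w) ≤
      svFunction s' (wordProd A w) * Real.exp (n * ε) := by
    intro w
    have h1 := sv₁_wordProd_pos A w
    have h2 := sv₂_wordProd_pos A w
    rw [svFunction_of_one_lt hdim, svFunction_of_one_lt (hdim.trans_le hss'), mul_assoc]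
    refine mul_le_mul_of_nonneg_left ?_ h1.le
    have h3 : sv₂ (wordProd A w) ^ (s - 1) =
        sv₂ (wordProd A w) ^ (s' - 1) * sv₂ (wordProd A w) ^ (s - s') := by
      rw [← Real.rpow_add h2]; ring_nf
    rw [h3]
    refine mul_le_mul_of_nonneg_left ?_ (Real.rpow_nonneg h2.le _)
    rw [Real.rpow_def_of_pos h2, Real.exp_le_exp]
    have h4 := Real.log_le_log (pow_pos hκ₀ n) (le_sv₂_wordProd A hκ₀.le hκ w)
    rw [Real.log_pow] at h4
    have h5 : (s' - s) * -Real.log κ ≤ ε := by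
      rw [← le_div_iff₀ (neg_pos.2 hlogκ)]
      linarith
    have h6 : (0 : ℝ) ≤ n := Nat.cast_nonneg n
    nlinarith [mul_le_mul_of_nonneg_left h5 h6, mul_le_mul_of_nonneg_right h4 (sub_nonneg.2 hss')]
  calc ∑ w : Fin n → Fin m, svFunction s (wordProd A w) ≤
        ∑ w : Fin n → Fin m, svFunction s' (wordProd A w) * Real.exp (n * ε) :=
        Finset.sum_le_sum fun w _ => hterm w
    _ = (∑ w : Fin n → Fin m, svFunction s' (wordProd A w)) * Real.exp (n * ε) :=
        (Finset.sum_mul _ _ _).symm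
    _ ≤ 1 * Real.exp (n * ε) := by gcongr
    _ = _ := one_mul _

end SingularValueSums

/-! ### Bounds for the dimensions from above and below -/

section Bounds

variable {m : ℕ} (A : Fin m → GL (Fin 2) ℝ) (d : Fin m → ℝ²)

theorem lipschitzWith_projAlong (θ : RP1) : LipschitzWith 1 (projAlong θ) :=
  lipschitzWith_detProj_div θ.rep θ.rep_nonzero

/-- If some projection of the attractor has positive measure, then the sum defining the affinity
dimension diverges for all exponents up to one. -/
theorem one_lt_of_summable_svFunction (hA : ∀ i, sv₁ (A i : Matrix (Fin 2) (Fin 2) ℝ) < 1)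
    {E : Set ℝ²} (hE : E = ⋃ i, affineMapOf (A i) (d i) '' E) (hE_compact : IsCompact E)
    {θ : RP1} (hθ : 0 < volume (projAlong θ '' E)) {s : ℝ}
    (hs : Summable fun n : ℕ => ∑ w : Fin (n + 1) → Fin m, svFunction s (wordProd A w)) :
    1 < s := by
  by_contra! hs1
  obtain ⟨x₀, hx₀⟩ : E.Nonempty := by
    rw [Set.nonempty_iff_ne_empty]
    rintro rfl
    simp at hθ
  obtain ⟨R, hR⟩ := hE_compact.isBounded.subset_closedBall x₀
  have hR₀ : 0 ≤ R := by simpa using hR hx₀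
  have hbound : ∀ n : ℕ, volume (projAlong θ '' E) ≤ ENNReal.ofReal
      (2 * R * ∑ w : Fin (n + 1) → Fin m, svFunction s (wordProd A w)) := by
    intro n
    refine (volume_image_le_of_cover (lipschitzWith_projAlong θ)
      (Finset.univ : Finset (Fin (n + 1) → Fin m)) (fun w => wordMap A d w x₀)
      (fun w => sv₁ (wordProd A w) * R) (fun w _ => mul_nonneg (sv₁_nonneg _) hR₀) ?_).trans ?_
    · intro x hx
      obtain ⟨a, ha⟩ := exists_coding A d hE hx
      obtain ⟨y, hy, hyx⟩ := ha (n + 1)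
      refine ⟨_, Finset.mem_univ (initialWord a (n + 1)), ?_⟩
      rw [← hyx, dist_eq_norm, wordMap_sub]
      refine (norm_act_le _ _).trans (mul_le_mul_of_nonneg_left ?_ (sv₁_nonneg _))
      rw [← dist_eq_norm]
      exact hR hy
    · refine ENNReal.ofReal_le_ofReal ?_
      rw [Finset.mul_sum]
      refine Finset.sum_le_sum fun w _ => ?_
      have h1 : sv₁ (wordProd A w) ≤ 1 := by
        have := sv₁_wordProd_le A (fun i => (hA i).le) w
        rwa [one_pow] at this
      have h2 : sv₁ (wordProd A w) ≤ svFunction s (wordProd A w) := by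
        rw [svFunction, if_pos hs1]
        conv_lhs => rw [← Real.rpow_one (sv₁ (wordProd A w))]
        exact Real.rpow_le_rpow_of_exponent_ge (sv₁_wordProd_pos A w) h1 hs1
      nlinarith
  have hlim := (ENNReal.continuous_ofReal.tendsto _).comp
    (hs.tendsto_atTop_zero.const_mul (2 * R))
  rw [mul_zero, ENNReal.ofReal_zero] at hlim
  exact hθ.not_ge (ge_of_tendsto' hlim hbound)

/-- The classical upper bound: cover the piece of each word `w` for which `α₂(A_w)` is first below
`r` by about `α₁(A_w) / α₂(A_w)` balls of radius about `r`. -/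
theorem exists_coveringNumber_le (hA : ∀ i, sv₁ (A i : Matrix (Fin 2) (Fin 2) ℝ) < 1)
    {E : Set ℝ²} (hE : E = ⋃ i, affineMapOf (A i) (d i) '' E) (hE_compact : IsCompact E)
    (hE_ne : E.Nonempty) {s : ℝ} (hs1 : 1 < s)
    (hs : Summable fun n : ℕ => ∑ w : Fin (n + 1) → Fin m, svFunction s (wordProd A w)) :
    ∃ C : ℝ, ∀ᶠ ε : ℝ≥0 in 𝓝[>] 0,
      ((Metric.externalCoveringNumber ε E).toNat : ℝ) ≤ C * (ε : ℝ) ^ (-s) := by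
  classical
  obtain ⟨ρ, hρ₀, hρ₁, hρ⟩ := exists_sv₁_lt_one A hA
  obtain ⟨κ, hκ₀, hκ₁, hκ⟩ := exists_sv₂_pos A
  obtain ⟨x₀, hx₀⟩ := hE_ne
  obtain ⟨R, hR⟩ := hE_compact.isBounded.subset_closedBall x₀
  have hR₀ : 0 ≤ R := by simpa using hR hx₀
  set Z := ∑' n : ℕ, ∑ w : Fin (n + 1) → Fin m, svFunction s (wordProd A w) with hZ
  refine ⟨(2 * R + 5) * (κ / (1 + R)) ^ (-s) * Z, ?_⟩
  have hmem : Set.Ioo (0 : ℝ≥0) 1 ∈ 𝓝[>] (0 : ℝ≥0) := Ioo_mem_nhdsGT one_pos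
  filter_upwards [hmem] with ε hε
  have hε₀ : (0 : ℝ) < ε := hε.1
  have hε₁ : (ε : ℝ) < 1 := hε.2
  set r : ℝ := ε / (1 + R) with hr
  have hr₀ : 0 < r := by positivity
  have hr₁ : r < 1 := by
    rw [hr, div_lt_one (by positivity)]
    linarith
  obtain ⟨L, hL⟩ : ∃ L : ℕ, ρ ^ L < r := exists_pow_lt_of_lt_one hr₀ hρ₁
  have hcov := fun (n : ℕ) (w : Fin (n + 1) → Fin m) => exists_ellipse_cover (wordGL A w) hR₀
  simp only [coe_wordGL] at hcov
  choose D hDcard hD using hcov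
  set W : ∀ n : ℕ, Finset (Fin (n + 1) → Fin m) := fun n =>
    Finset.univ.filter fun w => κ * r ≤ sv₂ (wordProd A w) ∧ sv₂ (wordProd A w) ≤ r with hW
  set C : Finset ℝ² := (Finset.range L).biUnion fun n => (W n).biUnion fun w =>
    (D n w).image fun c => wordMap A d w x₀ + c with hC
  have hcover : ∀ x ∈ E, ∃ c ∈ C, dist x c ≤ ε := by
    intro x hx
    obtain ⟨a, ha⟩ := exists_coding A d hE hx
    have hsmall : ∀ n, sv₂ (wordProd A (initialWord a n)) ≤ ρ ^ n := fun n =>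
      (sv₂_le_sv₁ _).trans (sv₁_wordProd_le A hρ _)
    have hex : ∃ n, sv₂ (wordProd A (initialWord a n)) ≤ r := ⟨L, (hsmall L).trans hL.le⟩
    obtain ⟨n, hn, hnmin⟩ : ∃ n, sv₂ (wordProd A (initialWord a (n + 1))) ≤ r ∧
        r < sv₂ (wordProd A (initialWord a n)) := by
      have h0 : Nat.find hex ≠ 0 := by
        intro h
        have := Nat.find_spec hex
        rw [h, wordProd_zero, sv₂_one] at this
        linarith
      obtain ⟨n, hn⟩ := Nat.exists_eq_succ_of_ne_zero h0
      refine ⟨n, ?_, not_le.1 (Nat.find_min hex (by omega))⟩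
      have := Nat.find_spec hex
      rwa [hn] at this
    have hnL : n < L := by
      by_contra hcon
      have := pow_le_pow_of_le_one hρ₀.le hρ₁.le (not_lt.1 hcon)
      linarith [hsmall n]
    have hlow : κ * r ≤ sv₂ (wordProd A (initialWord a (n + 1))) := by
      rw [wordProd_succ_last]
      refine le_trans ?_ (mul_sv₂_le _ _)
      rw [mul_comm]
      exact mul_le_mul hnmin.le (hκ _) hκ₀.le (sv₂_nonneg _)
    obtain ⟨y, hy, hyx⟩ := ha (n + 1)
    obtain ⟨c, hc, hyc⟩ := hD n (initialWord a (n + 1)) (y - x₀) (by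
      rw [← dist_eq_norm]; exact hR hy)
    refine ⟨wordMap A d (initialWord a (n + 1)) x₀ + c, ?_, ?_⟩
    · exact Finset.mem_biUnion.2 ⟨n, Finset.mem_range.2 hnL, Finset.mem_biUnion.2
        ⟨_, Finset.mem_filter.2 ⟨Finset.mem_univ _, hlow, hn⟩, Finset.mem_image_of_mem _ hc⟩⟩
    · rw [← wordMap_sub A d] at hyc
      rw [← hyx, dist_eq_norm, ← sub_sub]
      refine hyc.trans ?_
      calc (1 + R) * sv₂ (wordProd A (initialWord a (n + 1))) ≤ (1 + R) * r := by gcongr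
        _ = ε := by rw [hr]; field_simp
  have hword : ∀ n, ∀ w ∈ W n, ((D n w).card : ℝ) ≤
      (2 * R + 5) * (κ * r) ^ (-s) * svFunction s (wordProd A w) := by
    intro n w hw
    obtain ⟨-, hw1, hw2⟩ := Finset.mem_filter.1 hw
    have h1 := sv₁_wordProd_pos A w
    have h2 := sv₂_wordProd_pos A w
    refine (hDcard n w).trans ?_
    rw [mul_assoc (2 * R + 5)]
    refine mul_le_mul_of_nonneg_left ?_ (by positivity)
    have h3 : sv₁ (wordProd A w) / sv₂ (wordProd A w) =
        sv₂ (wordProd A w) ^ (-s) * svFunction s (wordProd A w) := by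
      rw [svFunction_of_one_lt hs1, mul_left_comm, ← Real.rpow_add h2, div_eq_mul_inv,
        ← Real.rpow_neg_one]
      ring_nf
    rw [h3]
    refine mul_le_mul_of_nonneg_right ?_ (svFunction_pos A s w).le
    exact Real.rpow_le_rpow_of_nonpos (by positivity) hw1 (by linarith)
  calc ((Metric.externalCoveringNumber ε E).toNat : ℝ) ≤ C.card := by
        exact_mod_cast coveringNumber_toNat_le C hcover
    _ ≤ ∑ n ∈ Finset.range L, ∑ w ∈ W n, ((D n w).card : ℝ) := by
        have h : C.card ≤ ∑ n ∈ Finset.range L, ∑ w ∈ W n, (D n w).card := by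
          refine Finset.card_biUnion_le.trans (Finset.sum_le_sum fun n _ => ?_)
          exact Finset.card_biUnion_le.trans (Finset.sum_le_sum fun w _ => Finset.card_image_le)
        exact_mod_cast h
    _ ≤ ∑ n ∈ Finset.range L, ∑ w : Fin (n + 1) → Fin m,
          (2 * R + 5) * (κ * r) ^ (-s) * svFunction s (wordProd A w) := by
        refine Finset.sum_le_sum fun n _ => (Finset.sum_le_sum (hword n)).trans ?_
        exact Finset.sum_le_sum_of_subset_of_nonneg (Finset.subset_univ _) fun w _ _ =>
          mul_nonneg (by positivity) (svFunction_pos A s w).le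
    _ = (2 * R + 5) * (κ * r) ^ (-s) * ∑ n ∈ Finset.range L, ∑ w : Fin (n + 1) → Fin m,
          svFunction s (wordProd A w) := by
        rw [Finset.mul_sum]
        exact Finset.sum_congr rfl fun n _ => (Finset.mul_sum _ _ _).symm
    _ ≤ (2 * R + 5) * (κ * r) ^ (-s) * Z := by
        refine mul_le_mul_of_nonneg_left ?_ (by positivity)
        exact hs.sum_le_tsum _ fun n _ =>
          Finset.sum_nonneg fun w _ => (svFunction_pos A s w).le
    _ = _ := by
        rw [show κ * r = κ / (1 + R) * ε by rw [hr]; ring,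
          Real.mul_rpow (by positivity) hε₀.le]
        ring

/-- A projection of positive measure bounds the covering numbers below by a multiple of
`1 / ε`. -/
theorem exists_le_coveringNumber_of_proj {E : Set ℝ²} (hE_compact : IsCompact E) {θ : RP1}
    (hθ : 0 < volume (projAlong θ '' E)) :
    ∃ c : ℝ, 0 < c ∧ ∀ ε : ℝ≥0, 0 < ε →
      c * (ε : ℝ) ^ (-1 : ℝ) ≤ ((Metric.externalCoveringNumber ε E).toNat : ℝ) := by
  obtain ⟨l, -, hl⟩ := ENNReal.lt_iff_exists_real_btwn.1 hθ
  have hl₀ : 0 < l := by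
    by_contra h0
    simp [ENNReal.ofReal_of_nonpos (not_lt.1 h0)] at hl
  refine ⟨l / 2, by positivity, fun ε hε => ?_⟩
  have hε' : (0 : ℝ) < ε := hε
  obtain ⟨C, hC, hcard⟩ := exists_finset_cover hE_compact hε
  have h := sum_le_mul_card_of_separated {()} (fun _ => E) (fun _ => projAlong θ)
    (fun _ _ => lipschitzWith_projAlong θ) (fun _ => l) (fun _ _ => hl.2.le) C ε.2
    (fun _ _ => hC) (fun _ _ _ _ hne => absurd rfl hne)
  rw [Finset.sum_singleton, hcard] at h
  rw [Real.rpow_neg_one, ← div_eq_mul_inv, div_le_iff₀ hε']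
  change l ≤ 2 * (ε : ℝ) * _ at h
  linarith

end Bounds

/-! ### Many visiting words -/

/-- A log-sum inequality: if entropy plus energy is nearly maximal, then a set of large probability
carries a large part of the partition function. -/
theorem sum_negMulLog_add_sum_log_le {ι : Type*} [Fintype ι] (p φ : ι → ℝ) (hp : ∀ i, 0 ≤ p i)
    (hp1 : ∑ i, p i = 1) (hφ : ∀ i, 0 < φ i) (S : Finset ι) (hS : S.Nonempty) :
    ∑ i, Real.negMulLog (p i) + ∑ i, p i * Real.log (φ i) ≤ Real.log 2 +
      (∑ i ∈ S, p i) * Real.log (∑ i ∈ S, φ i) +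
      (1 - ∑ i ∈ S, p i) * Real.log (∑ i, φ i) := by
  classical
  set Φ := ∑ i ∈ S, φ i with hΦ
  set Z := ∑ i, φ i with hZ
  have hΦ₀ : 0 < Φ := Finset.sum_pos (fun i _ => hφ i) hS
  have hZ₀ : 0 < Z := hΦ₀.trans_le
    (Finset.sum_le_sum_of_subset_of_nonneg (Finset.subset_univ S) fun i _ _ => (hφ i).le)
  set c : ι → ℝ := fun i => if i ∈ S then Φ else Z with hc
  have hc₀ : ∀ i, 0 < c i := fun i => by
    simp only [hc]
    split_ifs <;> assumption
  -- half of the comparison weight is spread over `S`, the other half over everything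
  have hq : ∑ i, φ i / (2 * c i) ≤ ∑ i, p i := by
    have h1 : ∀ i, φ i / (2 * c i) ≤ (if i ∈ S then φ i / (2 * Φ) else 0) + φ i / (2 * Z) := by
      intro i
      have h2 : 0 < φ i / (2 * Z) := div_pos (hφ i) (by positivity)
      simp only [hc]
      split_ifs
      · linarith
      · simp
    refine (Finset.sum_le_sum fun i _ => h1 i).trans ?_
    rw [Finset.sum_add_distrib, ← Finset.sum_filter, Finset.filter_mem_eq_inter, Finset.univ_inter,
      ← Finset.sum_div, ← Finset.sum_div, ← hΦ, ← hZ, hp1]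
    refine le_of_eq ?_
    field_simp
    norm_num
  have hgibbs := sum_negMulLog_le p (fun i => φ i / (2 * c i)) hp
    (fun i => (div_pos (hφ i) (mul_pos two_pos (hc₀ i))).le)
    (fun i _ => (div_pos (hφ i) (mul_pos two_pos (hc₀ i))).ne') hq
  have hlog : ∀ i, p i * -Real.log (φ i / (2 * c i)) =
      p i * Real.log 2 - p i * Real.log (φ i) + p i * Real.log (c i) := by
    intro i
    rw [Real.log_div (hφ i).ne' (mul_pos two_pos (hc₀ i)).ne', Real.log_mul two_ne_zero (hc₀ i).ne']
    ring
  have hsumc : ∑ i, p i * Real.log (c i) =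
      (∑ i ∈ S, p i) * Real.log Φ + (1 - ∑ i ∈ S, p i) * Real.log Z := by
    rw [← Finset.sum_add_sum_compl S, ← hp1, ← Finset.sum_add_sum_compl S p, add_sub_cancel_left,
      Finset.sum_mul, Finset.sum_mul]
    congr 1
    · exact Finset.sum_congr rfl fun i hi => by simp [hc, hi]
    · exact Finset.sum_congr rfl fun i hi => by simp [hc, Finset.mem_compl.1 hi]
  simp only [hlog] at hgibbs
  rw [Finset.sum_add_distrib, Finset.sum_sub_distrib, ← Finset.sum_mul, hp1, hsumc] at hgibbs
  linarith

section Averages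

variable {m : ℕ} (μ : Measure (ℕ → Fin m)) [IsProbabilityMeasure μ]
  {f : ∀ n : ℕ, (Fin n → Fin m) → ℝ} {l : ℝ}

theorem tendsto_sum_measureReal_mul {K : ℝ} (hK : ∀ n w, |f n w| ≤ K)
    (hf : ∀ᵐ a ∂μ, Tendsto (fun n => f n (initialWord a n)) atTop (𝓝 l)) :
    Tendsto (fun n => ∑ w, μ.real ((fun a => initialWord a n) ⁻¹' {w}) * f n w) atTop (𝓝 l) := by
  have h := tendsto_integral_of_dominated_convergence (μ := μ)
    (F := fun n a => f n (initialWord a n)) (f := fun _ => l) (fun _ => K)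
    (fun n => ((measurable_of_finite (f n)).comp (measurable_initialWord n)).aestronglyMeasurable)
    (integrable_const K) (fun n => Eventually.of_forall fun a => hK n _) hf
  simp only [integral_const, probReal_univ, one_smul] at h
  exact h.congr fun n => integral_comp_eq_sum μ (measurable_initialWord n) (f n)

theorem eventually_measureReal_abs_sub_le
    (hf : ∀ᵐ a ∂μ, Tendsto (fun n => f n (initialWord a n)) atTop (𝓝 l)) {ε q : ℝ}
    (hε : 0 < ε) (hq : 0 < q) :
    ∀ᶠ n in atTop, μ.real {a | ε ≤ |f n (initialWord a n) - l|} ≤ q := by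
  have h := tendstoInMeasure_of_tendsto_ae (μ := μ) (f := fun n a => f n (initialWord a n))
    (g := fun _ => l)
    (fun n => ((measurable_of_finite (f n)).comp (measurable_initialWord n)).aestronglyMeasurable)
    hf
  rw [tendstoInMeasure_iff_norm] at h
  filter_upwards [(h ε hε).eventually (gt_mem_nhds (ENNReal.ofReal_pos.2 hq))] with n hn
  exact ENNReal.toReal_le_of_le_ofReal hq.le hn.le

end Averages

section ManyWords

variable {m : ℕ} (A : Fin m → GL (Fin 2) ℝ)

theorem abs_log_sv_div_le (hA : ∀ i, sv₁ (A i : Matrix (Fin 2) (Fin 2) ℝ) < 1) {κ : ℝ}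
    (hκ₀ : 0 < κ) (hκ : ∀ i, κ ≤ sv₂ (A i : Matrix (Fin 2) (Fin 2) ℝ))
    {n : ℕ} (w : Fin n → Fin m) {x : ℝ} (hx : sv₂ (wordProd A w) ≤ x)
    (hx' : x ≤ sv₁ (wordProd A w)) : |Real.log x / n| ≤ |Real.log κ| := by
  have h0 := sv₂_wordProd_pos A w
  have h1 := sv₁_wordProd_le A (fun i => (hA i).le) w
  rw [one_pow] at h1
  have h2 := Real.log_le_log (pow_pos hκ₀ n) ((le_sv₂_wordProd A hκ₀.le hκ w).trans hx)
  rw [Real.log_pow] at h2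
  have h3 := Real.log_nonpos (h0.le.trans hx) (hx'.trans h1)
  rcases Nat.eq_zero_or_pos n with rfl | hn
  · simp
  have hn' : (0 : ℝ) < n := by exact_mod_cast hn
  rw [abs_div, abs_of_pos hn', div_le_iff₀ hn', abs_of_nonpos h3]
  nlinarith [neg_abs_le (Real.log κ)]

theorem lyapunov_lt_zero (hA : ∀ i, sv₁ (A i : Matrix (Fin 2) (Fin 2) ℝ) < 1)
    {μ : Measure (ℕ → Fin m)} [IsProbabilityMeasure μ] {l₁ l₂ : ℝ}
    (hl : AreLyapunovExponents A μ l₁ l₂) : l₁ < 0 ∧ l₂ < 0 := by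
  obtain ⟨ρ, hρ₀, hρ₁, hρ⟩ := exists_sv₁_lt_one A hA
  obtain ⟨a, h1, h2⟩ := hl.exists
  have hle : ∀ {n : ℕ}, 0 < n → ∀ x, 0 < x → x ≤ sv₁ (wordProd A (initialWord a n)) →
      Real.log x / n ≤ Real.log ρ := by
    intro n hn x hx hx'
    have hn' : (0 : ℝ) < n := by exact_mod_cast hn
    rw [div_le_iff₀ hn', mul_comm, ← Real.log_pow]
    exact Real.log_le_log hx (hx'.trans (sv₁_wordProd_le A hρ _))
  have hlogρ := Real.log_neg hρ₀ hρ₁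
  constructor
  · refine (le_of_tendsto h1 ?_).trans_lt hlogρ
    filter_upwards [eventually_gt_atTop 0] with n hn
    exact hle hn _ (sv₁_wordProd_pos A _) le_rfl
  · refine (le_of_tendsto h2 ?_).trans_lt hlogρ
    filter_upwards [eventually_gt_atTop 0] with n hn
    exact hle hn _ (sv₂_wordProd_pos A _) (sv₂_le_sv₁ _)

/-- For a measure of full Lyapunov dimension, every sequence of sets of words of probability
bounded below contains words with `α₂` of the expected size that carry at least
an `e^(-o(n))` part of the singular value sum. -/
theorem eventually_exists_heavy_words (hA : ∀ i, sv₁ (A i : Matrix (Fin 2) (Fin 2) ℝ) < 1)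
    (hdim : 1 < affinityDim A) (μ : Measure (ℕ → Fin m)) [IsProbabilityMeasure μ]
    (hμ : MeasurePreserving leftShift μ μ) {h l₁ l₂ : ℝ}
    (hh : ksEntropy leftShift μ = (h : EReal)) (hl : AreLyapunovExponents A μ l₁ l₂)
    (heq : h + l₁ + (affinityDim A - 1) * l₂ = 0) {V : ∀ n : ℕ, Set (Fin n → Fin m)} {p : ℝ}
    (hp : 0 < p) (hV : ∀ n, p ≤ μ.real {a | initialWord a n ∈ V n}) {ε : ℝ} (hε : 0 < ε) :
    ∀ᶠ n : ℕ in atTop, ∃ S : Finset (Fin n → Fin m),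
      (∀ w ∈ S, w ∈ V n ∧ Real.exp (n * (l₂ - ε)) ≤ sv₂ (wordProd A w) ∧
        sv₂ (wordProd A w) ≤ Real.exp (n * (l₂ + ε))) ∧
      Real.exp (-(Real.log 2 + 2 * n * ε) * (2 / p)) ≤
        ∑ w ∈ S, svFunction (affinityDim A) (wordProd A w) := by
  classical
  obtain ⟨κ, hκ₀, hκ₁, hκ⟩ := exists_sv₂_pos A
  set s := affinityDim A with hs
  have hlog : ∀ {n : ℕ} (w : Fin n → Fin m), Real.log (svFunction s (wordProd A w)) =
      Real.log (sv₁ (wordProd A w)) + (s - 1) * Real.log (sv₂ (wordProd A w)) := by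
    intro n w
    have h1 := sv₁_wordProd_pos A w
    have h2 := sv₂_wordProd_pos A w
    rw [svFunction_of_one_lt hdim, Real.log_mul h1.ne' (Real.rpow_pos_of_pos h2 _).ne',
      Real.log_rpow h2]
  have hlim : ∀ᵐ a ∂μ, Tendsto (fun n : ℕ =>
      Real.log (svFunction s (wordProd A (initialWord a n))) / n) atTop
      (𝓝 (l₁ + (s - 1) * l₂)) := by
    filter_upwards [hl] with a ha
    refine (ha.1.add (ha.2.const_mul (s - 1))).congr fun n => ?_
    rw [hlog]
    ring
  have hK : ∀ (n : ℕ) (w : Fin n → Fin m), |Real.log (svFunction s (wordProd A w)) / n| ≤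
      |Real.log κ| + (s - 1) * |Real.log κ| := by
    intro n w
    rw [hlog, add_div, mul_div_assoc]
    refine (abs_add_le _ _).trans ?_
    rw [abs_mul, abs_of_pos (sub_pos.2 hdim)]
    exact add_le_add (abs_log_sv_div_le A hA hκ₀ hκ w (sv₂_le_sv₁ _) le_rfl)
      (mul_le_mul_of_nonneg_left (abs_log_sv_div_le A hA hκ₀ hκ w le_rfl (sv₂_le_sv₁ _))
        (sub_pos.2 hdim).le)
  have hmean := tendsto_sum_measureReal_mul μ
    (f := fun n w => Real.log (svFunction s (wordProd A w)) / n) hK hlim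
  have hdev := eventually_measureReal_abs_sub_le μ
    (f := fun n w => Real.log (sv₂ (wordProd A w)) / n) (hl.mono fun a ha => ha.2) hε (half_pos hp)
  filter_upwards [hmean.eventually (lt_mem_nhds (sub_lt_self _ hε)), hdev,
    eventually_sum_svFunction_le A hA hdim hε, eventually_gt_atTop 0] with n hmean hdev hZ hn
  have hn' : (0 : ℝ) < n := by exact_mod_cast hn
  set P : (Fin n → Fin m) → ℝ := fun w => μ.real ((fun a => initialWord a n) ⁻¹' {w}) with hP
  have hPsum : ∑ w, P w = 1 := sum_measureReal_fiber μ (measurable_initialWord n)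
  set S : Finset (Fin n → Fin m) := Finset.univ.filter fun w => w ∈ V n ∧
    |Real.log (sv₂ (wordProd A w)) / n - l₂| < ε with hS
  have hSP : p / 2 ≤ ∑ w ∈ S, P w := by
    have h1 : ∑ w ∈ S, P w = μ.real ((fun a => initialWord a n) ⁻¹' S) :=
      sum_measureReal_preimage_singleton S fun w _ =>
        measurable_initialWord n (measurableSet_singleton w)
    have h2 : {a | initialWord a n ∈ V n} ⊆ (fun a => initialWord a n) ⁻¹' S ∪
        {a | ε ≤ |Real.log (sv₂ (wordProd A (initialWord a n))) / n - l₂|} := by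
      intro a ha
      by_cases h3 : ε ≤ |Real.log (sv₂ (wordProd A (initialWord a n))) / n - l₂|
      · exact Or.inr h3
      · refine Or.inl ?_
        rw [Set.mem_preimage, Finset.mem_coe]
        exact Finset.mem_filter.2 ⟨Finset.mem_univ _, ha, not_le.1 h3⟩
    have h4 := (hV n).trans ((measureReal_mono h2).trans (measureReal_union_le _ _))
    rw [h1]
    linarith
  have hSle : ∑ w ∈ S, P w ≤ 1 := by
    rw [← hPsum]
    exact Finset.sum_le_sum_of_subset_of_nonneg (Finset.subset_univ _)
      fun _ _ _ => measureReal_nonneg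
  have hSne : S.Nonempty := by
    rw [Finset.nonempty_iff_ne_empty]
    intro h0
    rw [h0, Finset.sum_empty] at hSP
    linarith
  refine ⟨S, fun w hw => ?_, ?_⟩
  · obtain ⟨-, hwV, hw⟩ := Finset.mem_filter.1 hw
    have h2 := sv₂_wordProd_pos A w
    rw [abs_sub_lt_iff, sub_lt_iff_lt_add, sub_lt_comm, div_lt_iff₀ hn', lt_div_iff₀ hn'] at hw
    refine ⟨hwV, ?_, ?_⟩
    · rw [← Real.le_log_iff_exp_le h2]
      linarith
    · rw [← Real.log_le_iff_le_exp h2]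
      linarith
  · have hls := sum_negMulLog_add_sum_log_le P (fun w => svFunction s (wordProd A w))
      (fun _ => measureReal_nonneg) hPsum (fun w => svFunction_pos A s w) S hSne
    have hH : n * h ≤ ∑ w, Real.negMulLog (P w) := mul_ksEntropy_le_wordEntropy μ hμ hh n
    have hE : n * (l₁ + (s - 1) * l₂ - ε) ≤
        ∑ w, P w * Real.log (svFunction s (wordProd A w)) := by
      have h1 : ∑ w, P w * Real.log (svFunction s (wordProd A w)) =
          n * ∑ w, P w * (Real.log (svFunction s (wordProd A w)) / n) := by
        rw [Finset.mul_sum]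
        refine Finset.sum_congr rfl fun w _ => ?_
        field_simp
      rw [h1]
      exact mul_le_mul_of_nonneg_left hmean.le hn'.le
    have hΦ₀ : 0 < ∑ w ∈ S, svFunction s (wordProd A w) :=
      Finset.sum_pos (fun w _ => svFunction_pos A s w) hSne
    have hZ₀ : 0 < ∑ w : Fin n → Fin m, svFunction s (wordProd A w) :=
      Finset.sum_pos (fun w _ => svFunction_pos A s w) (hSne.mono (Finset.subset_univ _))
    have hlogZ := (Real.log_le_iff_le_exp hZ₀).2 hZ
    set t := ∑ w ∈ S, P w
    set Φ := ∑ w ∈ S, svFunction s (wordProd A w)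
    have h5 : (1 - t) * Real.log (∑ w : Fin n → Fin m, svFunction s (wordProd A w)) ≤ n * ε := by
      refine (mul_le_mul_of_nonneg_left hlogZ (by linarith)).trans ?_
      have : 0 ≤ n * ε := by positivity
      nlinarith
    have h6 : -(Real.log 2 + 2 * n * ε) ≤ t * Real.log Φ := by
      have : n * h + n * (l₁ + (s - 1) * l₂ - ε) = -(n * ε) := by
        linear_combination (n : ℝ) * heq
      linarith
    rw [← Real.le_log_iff_exp_le hΦ₀]
    have hlog2 : 0 < Real.log 2 := Real.log_pos one_lt_two
    have hX : 0 < Real.log 2 + 2 * n * ε := by positivity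
    rcases le_or_gt 0 (Real.log Φ) with h7 | h7
    · refine le_trans ?_ h7
      have : 0 < (Real.log 2 + 2 * n * ε) * (2 / p) := by positivity
      linarith
    · rw [mul_div_assoc', div_le_iff₀ hp]
      nlinarith

end ManyWords

/-! ### The lower bound for the covering numbers -/

/-- A lower bound along a geometric sequence of scales extends to all scales. -/
theorem exists_le_of_geometric_scales {N : ℝ≥0 → ℝ} {c₁ c₂ b t : ℝ} (hc₁ : 0 < c₁) (hc₂ : 0 < c₂)
    (hb : 0 < b) (ht : 0 < t)
    (h : ∀ᶠ n : ℕ in atTop, ∀ r : ℝ≥0, 0 < r → (r : ℝ) ≤ c₁ * Real.exp (-(n * b)) →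
      c₂ * Real.exp (n * (t * b)) ≤ N r) :
    ∃ c : ℝ, 0 < c ∧ ∀ᶠ ε : ℝ≥0 in 𝓝[>] 0, c * (ε : ℝ) ^ (-t) ≤ N ε := by
  refine ⟨c₂ * Real.exp (-(t * b)) * c₁ ^ t, by positivity, ?_⟩
  have hcoe : Tendsto (fun ε : ℝ≥0 => (ε : ℝ)) (𝓝[>] 0) (𝓝[>] 0) := by
    refine tendsto_nhdsWithin_iff.2 ⟨?_, ?_⟩
    · exact (NNReal.continuous_coe.tendsto 0).mono_left nhdsWithin_le_nhds
    · filter_upwards [self_mem_nhdsWithin] with ε hε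
      exact hε
  have hfloor : Tendsto (fun ε : ℝ≥0 => ⌊(Real.log c₁ - Real.log ε) / b⌋₊) (𝓝[>] 0) atTop := by
    refine tendsto_nat_floor_atTop.comp (Tendsto.atTop_div_const hb ?_)
    exact tendsto_atTop_add_const_left _ _
      (tendsto_neg_atBot_atTop.comp (Real.tendsto_log_nhdsGT_zero.comp hcoe))
  have hsmall : ∀ᶠ ε : ℝ≥0 in 𝓝[>] 0, (ε : ℝ) < c₁ :=
    hcoe.eventually (nhdsWithin_le_nhds (gt_mem_nhds hc₁))
  filter_upwards [hfloor.eventually h, hsmall, self_mem_nhdsWithin] with ε hε hεc hε₀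
  have hε₀' : (0 : ℝ) < ε := hε₀
  set n := ⌊(Real.log c₁ - Real.log ε) / b⌋₊ with hn
  have hlog : 0 ≤ (Real.log c₁ - Real.log ε) / b :=
    div_nonneg (sub_nonneg.2 (Real.log_le_log hε₀' hεc.le)) hb.le
  have h1 : n * b ≤ Real.log c₁ - Real.log ε := by
    have := Nat.floor_le hlog
    rwa [le_div_iff₀ hb] at this
  have h2 : Real.log c₁ - Real.log ε < (n + 1) * b := by
    have := Nat.lt_floor_add_one ((Real.log c₁ - Real.log ε) / b)
    rwa [div_lt_iff₀ hb] at this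
  refine le_trans ?_ (hε ε hε₀ ?_)
  · rw [mul_assoc, mul_assoc]
    refine mul_le_mul_of_nonneg_left ?_ hc₂.le
    rw [Real.rpow_def_of_pos hc₁, Real.rpow_def_of_pos hε₀', ← Real.exp_add, ← Real.exp_add,
      Real.exp_le_exp]
    nlinarith
  · rw [← Real.log_le_log_iff hε₀' (by positivity), Real.log_mul hc₁.ne' (Real.exp_pos _).ne',
      Real.log_exp]
    linarith

/-- The lower bound when the entropy exceeds `-λ₁`. The visiting words of typical size carry at
least an `e^(-o(n))` part of the singular value sum, their pieces are separated at the scale `r` of the smaller singular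
value, and each of them needs at least a constant times `α₁(A_w) / r` balls of radius `r`. -/
theorem exists_le_coveringNumber {m : ℕ} (A : Fin m → GL (Fin 2) ℝ)
    (d : Fin m → ℝ²) (hA_pos : ∀ i k l, 0 < (A i : Matrix (Fin 2) (Fin 2) ℝ) k l)
    (hA : ∀ i, sv₁ (A i : Matrix (Fin 2) (Fin 2) ℝ) < 1)
    {E : Set ℝ²} (hE : E = ⋃ i, affineMapOf (A i) (d i) '' E) (hE_compact : IsCompact E)
    (hsep : Pairwise fun i j =>
      Disjoint (affineMapOf (A i) (d i) '' E) (affineMapOf (A j) (d j) '' E))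
    (μ : Measure (ℕ → Fin m)) [IsProbabilityMeasure μ] (hμ : MeasurePreserving leftShift μ μ)
    {h l₁ l₂ : ℝ} (hh : ksEntropy leftShift μ = (h : EReal))
    (hl : AreLyapunovExponents A μ l₁ l₂) (hdim : 1 < affinityDim A)
    (heq : h + l₁ + (affinityDim A - 1) * l₂ = 0)
    {μF : Measure RP1} (hμF : IsFurstenbergMeasure A μ μF)
    (hproj : 0 < μF {θ : RP1 | 0 < volume (projAlong θ '' E)}) {t : ℝ} (ht₀ : 0 < t)
    (ht : t < affinityDim A) :
    ∃ c : ℝ, 0 < c ∧ ∀ᶠ ε : ℝ≥0 in 𝓝[>] 0,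
      c * (ε : ℝ) ^ (-t) ≤ ((Metric.externalCoveringNumber ε E).toNat : ℝ) := by
  have := hμF.isProbabilityMeasure
  set s := affinityDim A with hs
  obtain ⟨c, hc, hG⟩ := exists_closed_volume_projAlong_ge μF hproj
  set G := {θ : RP1 | ENNReal.ofReal c ≤ volume (projAlong θ '' E)} with hGdef
  have hGclosed : IsClosed G := isClosed_setOf_le_volume_projAlong hE_compact _
  have hp : 0 < μF.real G := ENNReal.toReal_pos hG.ne' (measure_ne_top _ _)
  set p := μF.real G with hpdef
  have hvisit := measureReal_le_visitingWords A hA_pos μ hμ hμF hGclosed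
  obtain ⟨τ, hτ, hlong⟩ := exists_long_projection A d hA_pos E hc
  obtain ⟨δ, hδ, hδsep⟩ := exists_separation_constant A d hE_compact hsep
  have hl₂ : l₂ < 0 := (lyapunov_lt_zero A hA hl).2
  -- all losses below are proportional to `ε`, and this choice keeps them below `(s - t) (-l₂)`
  set ε : ℝ := (s - t) * -l₂ / (t + s + 4 / p) with hε
  have hden : 0 < t + s + 4 / p := by positivity
  have hε₀ : 0 < ε := div_pos (mul_pos (sub_pos.2 ht) (neg_pos.2 hl₂)) hden
  have hεeq : ε * (t + s + 4 / p) = (s - t) * -l₂ := div_mul_cancel₀ _ hden.ne'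
  refine exists_le_of_geometric_scales (c₁ := δ / 3)
    (c₂ := τ / (2 * (δ / 3)) * Real.exp (-Real.log 2 * (2 / p))) (b := ε - l₂) (by positivity)
    (by positivity) (by linarith) ht₀ ?_
  filter_upwards [eventually_exists_heavy_words A hA hdim μ hμ hh hl heq hp hvisit hε₀,
    eventually_gt_atTop 0] with n hn hn0 r hr₀ hr
  obtain ⟨k, rfl⟩ : ∃ k, n = k + 1 := ⟨n - 1, by omega⟩
  obtain ⟨S, hS, hSsum⟩ := hn
  set n : ℝ := ((k + 1 : ℕ) : ℝ) with hndef
  have hn' : 0 ≤ n := Nat.cast_nonneg _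
  have hr₀' : (0 : ℝ) < r := hr₀
  obtain ⟨C, hC, hcard⟩ := exists_finset_cover hE_compact hr₀
  have hP := fun w : Fin (k + 1) → Fin m => fun hw : w ∈ visitingWords A G (k + 1) =>
    hlong k w hw
  choose P hPlip hPvol using hP
  classical
  have hcount := sum_le_mul_card_of_separated S (fun w => wordMap A d w '' E)
    (fun w => if hw : w ∈ visitingWords A G (k + 1) then P w hw else 0)
    (fun w hw => by rw [dif_pos (hS w hw).1]; exact hPlip w _)
    (fun w => τ * sv₁ (wordProd A w))
    (fun w hw => by rw [dif_pos (hS w hw).1]; exact hPvol w _) C hr₀'.le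
    (fun w _ x hx => by
      obtain ⟨y, hy, rfl⟩ := hx
      exact hC _ (wordMap_mem A d hE w hy))
    (fun w hw w' _ hne x hx y hy => by
      obtain ⟨x, hx, rfl⟩ := hx
      obtain ⟨y, hy, rfl⟩ := hy
      have h1 := wordMap_separation A d hE (fun i => (hA i).le) hδ.le hδsep 1 hne hx hy
      rw [one_mul, map_one, one_apply_eq_self, ← dist_eq_norm] at h1
      refine lt_of_lt_of_le ?_ h1
      have h2 := mul_le_mul_of_nonneg_left (hS w hw).2.1 hδ.le
      have h3 : -(n * (ε - l₂)) = n * (l₂ - ε) := by ring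
      rw [h3] at hr
      have h4 := Real.exp_pos (n * (l₂ - ε))
      have h5 : 0 < δ * Real.exp (n * (l₂ - ε)) := by positivity
      linarith)
  rw [hcard] at hcount
  have hsv : ∀ w ∈ S, svFunction s (wordProd A w) * Real.exp (n * (l₂ + ε) * (1 - s)) ≤
      sv₁ (wordProd A w) := by
    intro w hw
    have h2 := sv₂_wordProd_pos A w
    have h1 := sv₁_wordProd_pos A w
    rw [svFunction_of_one_lt hdim, mul_assoc]
    refine mul_le_of_le_one_right h1.le ?_
    have h3 : sv₂ (wordProd A w) ^ (s - 1) ≤ Real.exp (n * (l₂ + ε)) ^ (s - 1) :=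
      Real.rpow_le_rpow h2.le (hS w hw).2.2 (by linarith)
    rw [← Real.exp_mul] at h3
    calc _ ≤ Real.exp (n * (l₂ + ε) * (s - 1)) * Real.exp (n * (l₂ + ε) * (1 - s)) := by gcongr
      _ = 1 := by rw [← Real.exp_add, Real.exp_eq_one_iff]; ring
  have hsum : τ * (Real.exp (-(Real.log 2 + 2 * n * ε) * (2 / p)) *
      Real.exp (n * (l₂ + ε) * (1 - s))) ≤ ∑ w ∈ S, τ * sv₁ (wordProd A w) := by
    rw [← Finset.mul_sum]
    refine mul_le_mul_of_nonneg_left ?_ hτ.le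
    calc _ ≤ (∑ w ∈ S, svFunction s (wordProd A w)) * Real.exp (n * (l₂ + ε) * (1 - s)) := by
          gcongr
      _ ≤ _ := by
          rw [Finset.sum_mul]
          exact Finset.sum_le_sum hsv
  set N : ℝ := ((Metric.externalCoveringNumber r E).toNat : ℝ) with hN
  have hN₀ : 0 ≤ N := Nat.cast_nonneg _
  have htot : τ * (Real.exp (-(Real.log 2 + 2 * n * ε) * (2 / p)) *
      Real.exp (n * (l₂ + ε) * (1 - s))) ≤ 2 * (δ / 3 * Real.exp (-(n * (ε - l₂)))) * N :=
    hsum.trans (hcount.trans (by gcongr))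
  have hexp : Real.exp (-Real.log 2 * (2 / p)) * Real.exp (n * (t * (ε - l₂))) *
      Real.exp (-(n * (ε - l₂))) ≤ Real.exp (-(Real.log 2 + 2 * n * ε) * (2 / p)) *
      Real.exp (n * (l₂ + ε) * (1 - s)) := by
    rw [← Real.exp_add, ← Real.exp_add, ← Real.exp_add, Real.exp_le_exp]
    have h6 : 0 ≤ n * (2 * ε) := by positivity
    have h7 : n * (ε * (t + s + 4 / p)) = n * ((s - t) * -l₂) := by rw [hεeq]
    have h8 : -(Real.log 2 + 2 * n * ε) * (2 / p) =
        -Real.log 2 * (2 / p) - n * (ε * (4 / p)) := by ring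
    rw [h8]
    nlinarith
  have hfin : τ * (Real.exp (-Real.log 2 * (2 / p)) * Real.exp (n * (t * (ε - l₂)))) ≤
      2 * (δ / 3) * N := by
    have h9 := (mul_le_mul_of_nonneg_left hexp hτ.le).trans htot
    refine le_of_mul_le_mul_right ?_ (Real.exp_pos (-(n * (ε - l₂))))
    calc _ = τ * (Real.exp (-Real.log 2 * (2 / p)) * Real.exp (n * (t * (ε - l₂))) *
          Real.exp (-(n * (ε - l₂)))) := by ring
      _ ≤ _ := h9
      _ = _ := by ring
  rw [div_mul_eq_mul_div, div_mul_eq_mul_div, div_le_iff₀ (by positivity)]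
  linarith

/-! ### The box dimension -/

/-- Power bounds on the covering numbers, with exponents arbitrarily close to `s` on both sides,
determine the box dimension. -/
theorem hasBoxDim_of_bounds {E : Set ℝ²} (hE_compact : IsCompact E) (hE_ne : E.Nonempty) {s : ℝ}
    (hs : 0 < s)
    (hup : ∀ b, s < b → ∃ t < b, ∃ C : ℝ, ∀ᶠ ε : ℝ≥0 in 𝓝[>] 0,
      ((Metric.externalCoveringNumber ε E).toNat : ℝ) ≤ C * (ε : ℝ) ^ (-t))
    (hlow : ∀ t, 0 < t → t < s → ∃ c : ℝ, 0 < c ∧ ∀ᶠ ε : ℝ≥0 in 𝓝[>] 0,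
      c * (ε : ℝ) ^ (-t) ≤ ((Metric.externalCoveringNumber ε E).toNat : ℝ)) :
    HasBoxDim E s := by
  have hcoe : Tendsto (fun ε : ℝ≥0 => (ε : ℝ)) (𝓝[>] 0) (𝓝[>] 0) := by
    refine tendsto_nhdsWithin_iff.2 ⟨?_, ?_⟩
    · exact (NNReal.continuous_coe.tendsto 0).mono_left nhdsWithin_le_nhds
    · filter_upwards [self_mem_nhdsWithin] with ε hε
      exact hε
  have hlog : Tendsto (fun ε : ℝ≥0 => -Real.log (ε : ℝ)) (𝓝[>] 0) atTop :=
    tendsto_neg_atBot_atTop.comp (Real.tendsto_log_nhdsGT_zero.comp hcoe)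
  have hmodel : ∀ c t : ℝ, Tendsto (fun ε : ℝ≥0 => Real.log c / -Real.log (ε : ℝ) + t)
      (𝓝[>] 0) (𝓝 t) := by
    intro c t
    have := (hlog.const_div_atTop (Real.log c)).add_const t
    rwa [zero_add] at this
  have hlogmodel : ∀ {c t : ℝ} {ε : ℝ≥0}, 0 < c → 0 < (ε : ℝ) → 0 < -Real.log (ε : ℝ) →
      Real.log (c * (ε : ℝ) ^ (-t)) / -Real.log (ε : ℝ) =
        Real.log c / -Real.log (ε : ℝ) + t := by
    intro c t ε hc hε hL
    rw [Real.log_mul hc.ne' (Real.rpow_pos_of_pos hε _).ne', Real.log_rpow hε, add_div,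
      show -t * Real.log (ε : ℝ) = t * -Real.log (ε : ℝ) by ring, mul_div_cancel_right₀ _ hL.ne']
  have hpos : ∀ ε : ℝ≥0, 0 < ε → (0 : ℝ) < (Metric.externalCoveringNumber ε E).toNat := by
    intro ε hε
    obtain ⟨C, hC, hcard⟩ := exists_finset_cover hE_compact hε
    obtain ⟨x, hx⟩ := hE_ne
    obtain ⟨c, hc, -⟩ := hC x hx
    rw [← hcard]
    exact_mod_cast Finset.card_pos.2 ⟨c, hc⟩
  refine tendsto_order.2 ⟨fun b hb => ?_, fun b hb => ?_⟩
  · obtain ⟨t, htb, hts⟩ := exists_between (max_lt hb hs)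
    obtain ⟨hbt, ht₀⟩ := max_lt_iff.1 htb
    obtain ⟨c, hc, hev⟩ := hlow t ht₀ hts
    filter_upwards [hev, (hmodel c t).eventually (lt_mem_nhds hbt),
      hlog.eventually (eventually_gt_atTop 0), self_mem_nhdsWithin] with ε h1 h2 h3 h4
    have h4' : (0 : ℝ) < ε := h4
    rw [← hlogmodel hc h4' h3] at h2
    refine h2.trans_le (div_le_div_of_nonneg_right ?_ h3.le)
    exact Real.log_le_log (by positivity) h1
  · obtain ⟨t, htb, C, hev⟩ := hup b hb
    filter_upwards [hev, (hmodel C t).eventually (gt_mem_nhds htb),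
      hlog.eventually (eventually_gt_atTop 0), self_mem_nhdsWithin] with ε h1 h2 h3 h4
    have h4' : (0 : ℝ) < ε := h4
    have hC : 0 < C := pos_of_mul_pos_left ((hpos ε h4).trans_le h1)
      (Real.rpow_nonneg h4'.le _)
    rw [← hlogmodel hC h4' h3] at h2
    refine (div_le_div_of_nonneg_right ?_ h3.le).trans_lt h2
    exact Real.log_le_log (hpos ε h4) h1

theorem theorem1p2 {m : ℕ} (A : Fin m → GL (Fin 2) ℝ) (d : Fin m → EuclideanSpace ℝ (Fin 2))
    (hA_pos : ∀ i k l, 0 < (A i : Matrix (Fin 2) (Fin 2) ℝ) k l)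
    (hA_contr : ∀ i,
      ‖Matrix.toEuclideanCLM (𝕜 := ℝ) (A i : Matrix (Fin 2) (Fin 2) ℝ)‖ < 1)
    (E : Set (EuclideanSpace ℝ (Fin 2))) (hE_ne : E.Nonempty) (hE_compact : IsCompact E)
    (hE_attractor : E = ⋃ i, affineMapOf (A i) (d i) '' E)
    (hE_separation : Pairwise fun i j =>
      Disjoint (affineMapOf (A i) (d i) '' E) (affineMapOf (A j) (d j) '' E))
    (μ : Measure (ℕ → Fin m)) (hμ : IsKaenmakiMeasure A μ)
    (μF : Measure RP1) (hμF : IsFurstenbergMeasure A μ μF)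
    (hproj : 0 < μF {θ : RP1 | 0 < volume (projAlong θ '' E)}) :
    HasBoxDim E (affinityDim A) := by
  have hA : ∀ i, sv₁ (A i : Matrix (Fin 2) (Fin 2) ℝ) < 1 := fun i => by
    rw [sv₁_eq_norm]; exact hA_contr i
  obtain ⟨θ, hθ⟩ := nonempty_of_measure_ne_zero hproj.ne'
  rw [Set.mem_ofPred_eq] at hθ
  have hμprob := hμ.isProbabilityMeasure
  have hmem := exists_summable_svFunction A hA
  have hone : 1 ≤ affinityDim A := le_csInf hmem fun s hs =>
    (one_lt_of_summable_svFunction A d hA hE_attractor hE_compact hθ hs.2).le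
  obtain ⟨h, l₁, l₂, hh, hl, hdim⟩ := hμ.lyapunovDim_eq
  obtain ⟨hl₁, hl₂⟩ := lyapunov_lt_zero A hA hl
  refine hasBoxDim_of_bounds hE_compact hE_ne (by linarith) (fun b hb => ?_) fun t ht₀ ht => ?_
  · obtain ⟨s, hs, hsb⟩ := exists_lt_of_csInf_lt (s := {s : ℝ | 0 < s ∧
      Summable fun n : ℕ => ∑ w : Fin (n + 1) → Fin m, svFunction s (wordProd A w)}) hmem hb
    exact ⟨s, hsb, exists_coveringNumber_le A d hA hE_attractor hE_compact hE_ne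
      (one_lt_of_summable_svFunction A d hA hE_attractor hE_compact hθ hs.2) hs.2⟩
  rw [lyapunovDim] at hdim
  split_ifs at hdim with hcase
  · -- the Lyapunov dimension is at most one, so the affinity dimension equals one
    have hle : affinityDim A ≤ 1 := by
      rw [← hdim, div_le_one (by linarith)]
      exact hcase
    obtain ⟨c, hc, hN⟩ := exists_le_coveringNumber_of_proj hE_compact hθ
    refine ⟨c, hc, ?_⟩
    have hsmall : Set.Ioo (0 : ℝ≥0) 1 ∈ 𝓝[>] (0 : ℝ≥0) := Ioo_mem_nhdsGT one_pos
    filter_upwards [hsmall] with ε hε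
    refine le_trans (mul_le_mul_of_nonneg_left ?_ hc.le) (hN ε hε.1)
    exact Real.rpow_le_rpow_of_exponent_ge hε.1 (by exact_mod_cast hε.2.le) (by linarith)
  · have hgt : 1 < affinityDim A := by
      rw [← hdim]
      have : 0 < (h + l₁) / -l₂ := div_pos (by linarith) (by linarith)
      linarith
    refine exists_le_coveringNumber A d hA_pos hA hE_attractor hE_compact hE_separation μ
      hμ.ergodic.toMeasurePreserving hh hl hgt ?_ hμF hproj ht₀ ht
    rw [← hdim, add_sub_cancel_left, div_neg, neg_mul, div_mul_cancel₀ _ hl₂.ne]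
    ring

end
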